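/- Let $K$ be a field and let $E=(E^0,E^1,r,s)$ be an arbitrary directed graph. A finite path of length $n\ge 1$ is a sequence of edges $\xi_1\cdots\xi_n$ with $r(\xi_i)=s(\xi_{i+1})$; vertices are the paths of length $0$. Infinite paths are defined in the same way. *The free path groupoid.* For $e\in E^1$ let $e^*=e^{-1}$ be a ghost edge with $s(e^*)=r(e)$ and $r(e^*)=s(e)$. Let $G$ be the set consisting of all vertices and of all nonempty sequences $\alpha_1\cdots\alpha_n$ with $\alpha_i\in E^1\cup (E^1)^*$, $r(\alpha_i)=s(\alpha_{i+1})$, in which no subword $ee^*$ or $e^*e$ occurs. The product $gh$ is defined if and only if $r(g)=s(h)$, and is then the reduction of the concatenation of $g$ and $h$. This makes $G$ a groupoid whose identities are the vertices. Its set of composable pairs is denoted $G^2$. *The sets $X_g$ and maps $\theta_g$.* Let $X$ be the set of all infinite paths and of all finite paths (including paths of length $0$) whose range is a sink, i.e. a vertex that emits no edge. For a path $a$ of positive length, $X_a$ is the set of all $\xi\in X$ with initial subpath $a$, and $X_{a^{-1}}$ is the set of all $\xi\in X$ with $s(\xi)=r(a)$. For paths $a,b$ of positive length with $ab^{-1}\in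 G$ in reduced form, $X_{ab^{-1}}=X_a$. For $v\in E^0$, $X_v=\{\xi\in X: s(\xi)=v\}$. For all other $g\in G$, $X_g=\varnothing$. If $g=ab^{-1}$ in reduced form ($a$ or $b$ possibly of length $0$), then $\theta_g:X_{g^{-1}}\to X_g$ replaces the initial subpath $b$ by $a$: $\theta_g(b\eta)=a\eta$. *The algebra $D(X)$.* Let $1_g:X\to K$ be the characteristic function of $X_g$, let $D(X)=\operatorname{span}_K\{1_g:g\in G\}$ with pointwise operations, and for $g\in G$ let $D_g=1_gD(X)$. For $f\in D_{g^{-1}}$ let $\alpha_g(f)=f\circ\theta_{g^{-1}}$ on $X_g$, and $\alpha_g(f)=0$ off $X_g$. **Theorem.** The maps $\alpha_g$ are $K$-algebra isomorphisms $D_{g^{-1}}\to D_g$, and $(\{D_g\}_{g\in G},\{\alpha_g\}_{g\in G})$ is a partial action of the groupoid $G$ on the algebra $D(X)$; that is, $D_v$ is an ideal of $D(X)$ and $\alpha_v=\mathrm{id}_{D_v}$ for each $v\in E^0$, $D_g$ is an ideal of $D_{s(g)}$ for each $g \in G$, and for all $(g,h)\in G^2$ one has $\alpha_h^{-1}(D_{g^{-1}}\cap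 D_h)\subseteq D_{(gh)^{-1}}$ and $\alpha_g(\alpha_h(x))=\alpha_{gh}(x)$ for all $x\in\alpha_h^{-1}(D_{g^{-1}}\cap D_h)$. Let $D(X)\rtimes G$ be the associated partial skew groupoid ring: the $K$-module of all finite formal sums $\sum_{g\in G}a_g\delta_g$ with $a_g\in D_g$, and the bilinear product with $a_g\delta_g\cdot b_h\delta_h=\alpha_g(\alpha_{g^{-1}}(a_g)b_h)\delta_{gh}$ if $(g,h)\in G^2$, and $a_g\delta_g\cdot b_h\delta_h=0$ otherwise. Let $L_K(E)$ be the Leavitt path algebra, i.e. the universal (associative, not necessarily unital) $K$-algebra generated by $\{v,e,e^*:v\in E^0,e\in E^1\}$ with the relations 1. $v^2=v$, and $vw=0$ for vertices $v\ne w$; 2. $s(e)e=er(e)=e$; 3. $r(e)e^*=e^*s(e)=e^*$; 4. $e^*e=r(e)$, and $e^*f=0$ for edges $e\neq f$; 5. $v=\sum_{s(e)=v}ee^*$ for every vertex $v$ with $0<\#\{e\in E^1: s(e)=v\}<\infty$. Then there is an isomorphism of $K$-algebras $\phi:L_K(E)\to D(X)\rtimes G$ such that $\phi(e)=1_e\delta_e$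 and $\phi(e^*)=1_{e^{-1}}\delta_{e^{-1}}$ for all $e\in E^1$, and $\phi(v)=1_v\delta_v$ for all $v\in E^0$. -/

import Mathlib

open CategoryTheory
open scoped Classical DirectSum MonoidAlgebra

universe u v w

/-- A directed graph with vertex set `V`, edge set `E`, source map `s` and range map `r`. -/
structure DirectedGraph where
  V : Type u
  E : Type v
  s : E → V
  r : E → V

namespace DirectedGraph

variable (Γ : DirectedGraph.{u, v})

/-- A sink is a vertex that emits no edge. -/
def IsSink (x : Γ.V) : Prop := ∀ e : Γ.E, Γ.s e ≠ x

/-- For edges with source map `s` and range map `r`, the list of edges `l` is a path from the vertex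
`x` to the vertex `y` (the empty list being the path of length zero at a vertex). -/
def PathOf {V : Type u} {E : Type v} (s r : E → V) : V → List E → V → Prop
  | x, [], y => x = y
  | x, e :: l, y => s e = x ∧ PathOf s r (r e) l y

/-- `Γ.IsPath x l y`: the list of edges `l` is a finite path from `x` to `y`. -/
abbrev IsPath (x : Γ.V) (l : List Γ.E) (y : Γ.V) : Prop := PathOf Γ.s Γ.r x l y

/-- An infinite path `ξ₁ξ₂ξ₃…`. -/
def IsInfPath (ξ : Stream' Γ.E) : Prop := ∀ n, Γ.r (ξ.get n) = Γ.s (ξ.get (n + 1))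

/-- The letters of the free path groupoid: edges `e = (e, true)` and ghost edges
`e* = (e, false)`. -/
abbrev Letter : Type v := Γ.E × Bool

/-- The source of a letter; `s(e*) = r(e)`. -/
def ls : Γ.Letter → Γ.V
  | (e, true) => Γ.s e
  | (e, false) => Γ.r e

/-- The range of a letter; `r(e*) = s(e)`. -/
def lr : Γ.Letter → Γ.V
  | (e, true) => Γ.r e
  | (e, false) => Γ.s e

/-- `Γ.IsWalk x l y`: the sequence `l` of letters `e`, `e*` is a path from `x` to `y`. -/
abbrev IsWalk (x : Γ.V) (l : List Γ.Letter) (y : Γ.V) : Prop := PathOf Γ.ls Γ.lr x l y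

/-- The word `a`, for a list of edges `a`. -/
def pos (a : List Γ.E) : List Γ.Letter := a.map fun e => (e, true)

/-- The word `b⁻¹ = bₙ* ⋯ b₁*`, for a list of edges `b = b₁⋯bₙ`. -/
def neg (b : List Γ.E) : List Γ.Letter := (b.map fun e => (e, false)).reverse

variable {Γ}

theorem pathOf_append {V : Type u} {E : Type v} {s r : E → V} {x y : V} {l₁ l₂ : List E} :
    PathOf s r x (l₁ ++ l₂) y ↔ ∃ z, PathOf s r x l₁ z ∧ PathOf s r z l₂ y := by
  induction l₁ generalizing x with
  | nil => simp [PathOf]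
  | cons e l ih => simp [PathOf, ih, and_assoc]

theorem pathOf_end_unique {V : Type u} {E : Type v} {s r : E → V} {x y z : V} {l : List E}
    (h : PathOf s r x l y) (h' : PathOf s r x l z) : y = z := by
  induction l generalizing x with
  | nil => exact h.symm.trans h'
  | cons e l ih => exact ih h.2 h'.2

theorem isWalk_pos {x y : Γ.V} {a : List Γ.E} : Γ.IsWalk x (Γ.pos a) y ↔ Γ.IsPath x a y := by
  induction a generalizing x with
  | nil => rfl
  | cons e l ih => exact and_congr_right fun _ => ih

theorem isWalk_neg {x y : Γ.V} {b : List Γ.E} : Γ.IsWalk x (Γ.neg b) y ↔ Γ.IsPath y b x := by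
  induction b generalizing y with
  | nil => exact eq_comm
  | cons e l ih =>
    have hn : Γ.neg (e :: l) = Γ.neg l ++ [(e, false)] := by simp [neg]
    rw [hn, IsWalk, pathOf_append]
    constructor
    · rintro ⟨z, h1, h2, h3⟩
      have h2' : Γ.r e = z := h2
      have h3' : Γ.s e = y := h3
      subst h2'
      exact ⟨h3', ih.1 h1⟩
    · rintro ⟨h1, h2⟩
      exact ⟨Γ.r e, ih.2 h2, rfl, h1⟩

theorem isWalk_of_red {x y : Γ.V} {l l' : List Γ.Letter} (h : FreeGroup.Red l l')
    (hl : Γ.IsWalk x l y) : Γ.IsWalk x l' y := by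
  induction h with
  | refl => exact hl
  | tail _ hstep ih =>
    cases hstep with
    | @not L₁ L₂ e b =>
      obtain ⟨z, h1, h2, h3, h4⟩ := pathOf_append.1 ih
      refine pathOf_append.2 ⟨z, h1, ?_⟩
      have : Γ.lr (e, !b) = z := by
        rw [← h2]; cases b <;> rfl
      rw [← this]; exact h4

theorem isWalk_invRev {x y : Γ.V} {l : List Γ.Letter} (hl : Γ.IsWalk x l y) :
    Γ.IsWalk y (FreeGroup.invRev l) x := by
  induction l generalizing x with
  | nil => exact Eq.symm hl
  | cons a l ih =>
    rw [FreeGroup.invRev_cons]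
    refine pathOf_append.2 ⟨_, ih hl.2, ?_⟩
    have h1 := hl.1
    obtain ⟨e, b⟩ := a
    cases b
    · exact ⟨rfl, h1⟩
    · exact ⟨rfl, h1⟩

end DirectedGraph

open DirectedGraph

/-! ### The free path groupoid -/

/-- The free path groupoid of a graph, as a small category. Its identities are the vertices. -/
def FreePathGroupoid (Γ : DirectedGraph.{u, v}) : Type u := Γ.V

namespace FreePathGroupoid

variable {Γ : DirectedGraph.{u, v}}

/-- The vertex `x`, as an object of the free path groupoid. -/
def of (x : Γ.V) : FreePathGroupoid Γ := x

/-- The source and range vertices of an arrow are objects of the groupoid. -/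
def vertex (x : FreePathGroupoid Γ) : Γ.V := x

/-- Arrows from `x` to `y` are the irreducible sequences from `x` to `y` in the letters `e`, `e*`:
no subword `e e*` or `e* e` occurs, and the empty word stands for the vertex `x = y`. -/
structure Arr (x y : FreePathGroupoid Γ) : Type v where
  word : List Γ.Letter
  isWalk : Γ.IsWalk x.vertex word y.vertex
  isReduced : FreeGroup.IsReduced word

@[ext]
theorem Arr.ext' {x y : FreePathGroupoid Γ} {g h : Arr x y} (H : g.word = h.word) : g = h := by
  cases g; cases h; cases H; rfl

/-- The product of `g` and `h` is the reduction of their concatenation. It is written `g ≫ h` and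
is defined when the range of `g` is the source of `h`. -/
noncomputable instance : Groupoid (FreePathGroupoid Γ) where
  Hom x y := Arr x y
  id x := ⟨[], rfl, FreeGroup.IsReduced.nil⟩
  comp g h := ⟨FreeGroup.reduce (g.word ++ h.word),
    isWalk_of_red FreeGroup.reduce.red (pathOf_append.2 ⟨_, g.isWalk, h.isWalk⟩),
    FreeGroup.isReduced_iff_reduce_eq.2 FreeGroup.reduce.idem⟩
  id_comp g := Arr.ext' (by simpa using g.isReduced.reduce_eq)
  comp_id g := Arr.ext' (by simpa using g.isReduced.reduce_eq)
  assoc f g h := Arr.ext' (by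
    change FreeGroup.reduce (FreeGroup.reduce (f.word ++ g.word) ++ h.word) =
      FreeGroup.reduce (f.word ++ FreeGroup.reduce (g.word ++ h.word))
    conv_lhs => rw [← h.isReduced.reduce_eq]
    conv_rhs => rw [← f.isReduced.reduce_eq]
    rw [FreeGroup.reduce_append_reduce_reduce, FreeGroup.reduce_append_reduce_reduce,
      List.append_assoc])
  inv g := ⟨FreeGroup.invRev g.word, isWalk_invRev g.isWalk, by
    rw [FreeGroup.isReduced_iff_reduce_eq, FreeGroup.reduce_invRev, g.isReduced.reduce_eq]⟩
  inv_comp g := Arr.ext' FreeGroup.reduce_invRev_left_cancel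
  comp_inv g := Arr.ext' (by
    have := FreeGroup.reduce_invRev_left_cancel (L := FreeGroup.invRev g.word)
    rwa [FreeGroup.invRev_invRev] at this)

/-- The irreducible sequence underlying an arrow. -/
def word {x y : FreePathGroupoid Γ} (g : x ⟶ y) : List Γ.Letter := Arr.word g

theorem isWalk_word {x y : FreePathGroupoid Γ} (g : x ⟶ y) :
    Γ.IsWalk x.vertex (word g) y.vertex := Arr.isWalk g

theorem word_inv {x y : FreePathGroupoid Γ} (g : x ⟶ y) :
    word (Groupoid.inv g) = FreeGroup.invRev (word g) := rfl

theorem inv_inv' {x y : FreePathGroupoid Γ} (g : x ⟶ y) :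
    Groupoid.inv (Groupoid.inv g) = g :=
  Arr.ext' (FreeGroup.invRev_invRev)

/-- The edge `e`, as an arrow of the free path groupoid. -/
def ofEdge (e : Γ.E) : of (Γ.s e) ⟶ of (Γ.r e) :=
  (⟨[(e, true)], ⟨rfl, rfl⟩, FreeGroup.IsReduced.singleton⟩ : Arr _ _)

/-- `g = a b⁻¹` in reduced form, for finite paths `a` and `b` (possibly of length zero). -/
def IsFrac {x y : FreePathGroupoid Γ} (g : x ⟶ y) (a b : List Γ.E) : Prop :=
  word g = Γ.pos a ++ Γ.neg b

/-- The path `a`, when `g = a b⁻¹`: the maximal initial segment without ghost edges. -/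
def num {x y : FreePathGroupoid Γ} (g : x ⟶ y) : List Γ.E :=
  ((word g).takeWhile fun l => l.2).map Prod.fst

/-- The path `b`, when `g = a b⁻¹`. -/
def den {x y : FreePathGroupoid Γ} (g : x ⟶ y) : List Γ.E :=
  (((word g).dropWhile fun l => l.2).map Prod.fst).reverse

theorem IsFrac.num_eq {x y : FreePathGroupoid Γ} {g : x ⟶ y} {a b : List Γ.E}
    (h : IsFrac g a b) : num g = a := by
  have h1 : ∀ l : List Γ.E,
      (Γ.pos l ++ Γ.neg b).takeWhile (fun t : Γ.E × Bool => t.2) = Γ.pos l := by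
    intro l
    induction l with
    | nil =>
      rcases hb : Γ.neg b with _ | ⟨c, t⟩
      · rfl
      · have : c ∈ Γ.neg b := by rw [hb]; simp
        have hc : c.2 = false := by
          simp only [neg, List.mem_reverse, List.mem_map] at this
          obtain ⟨_, _, rfl⟩ := this
          rfl
        simp [pos, hc]
    | cons e l ih => simpa [pos] using ih
  unfold num
  rw [h, h1]
  simp [pos, Function.comp_def]

theorem IsFrac.den_eq {x y : FreePathGroupoid Γ} {g : x ⟶ y} {a b : List Γ.E}
    (h : IsFrac g a b) : den g = b := by
  have h1 : ∀ l : List Γ.E,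
      (Γ.pos l ++ Γ.neg b).dropWhile (fun t : Γ.E × Bool => t.2) = Γ.neg b := by
    intro l
    induction l with
    | nil =>
      rcases hb : Γ.neg b with _ | ⟨c, t⟩
      · rfl
      · have : c ∈ Γ.neg b := by rw [hb]; simp
        have hc : c.2 = false := by
          simp only [neg, List.mem_reverse, List.mem_map] at this
          obtain ⟨_, _, rfl⟩ := this
          rfl
        simp [pos, hc]
    | cons e l ih => simpa [pos] using ih
  unfold den
  rw [h, h1]
  simp [neg, Function.comp_def]

theorem IsFrac.inv {x y : FreePathGroupoid Γ} {g : x ⟶ y} {a b : List Γ.E}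
    (h : IsFrac g a b) : IsFrac (Groupoid.inv g) b a := by
  unfold IsFrac at h ⊢
  rw [word_inv, h]
  simp [FreeGroup.invRev, pos, neg, Function.comp_def]

/-- If `g = a b⁻¹` then `a` and `b` are paths with the same range, starting at the source and at
the range of `g`. -/
theorem IsFrac.exists_isPath {x y : FreePathGroupoid Γ} {g : x ⟶ y} {a b : List Γ.E}
    (h : IsFrac g a b) : ∃ z, Γ.IsPath x.vertex a z ∧ Γ.IsPath y.vertex b z := by
  have := isWalk_word g
  rw [h] at this
  obtain ⟨z, h1, h2⟩ := pathOf_append.1 this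
  exact ⟨z, isWalk_pos.1 h1, isWalk_neg.1 h2⟩

end FreePathGroupoid

open FreePathGroupoid

/-! ### The space `X` and the maps `θ_g` -/

/-- The set `X` of all finite paths ending in a sink (the vertices that are sinks, as paths of
length zero, included) and all infinite paths. -/
inductive BoundaryPath (Γ : DirectedGraph.{u, v}) : Type (max u v)
  | fin (x : Γ.V) (l : List Γ.E) (y : Γ.V) (hl : Γ.IsPath x l y) (hy : Γ.IsSink y)
  | inf (ξ : Stream' Γ.E) (h : Γ.IsInfPath ξ)

namespace BoundaryPath

variable {Γ : DirectedGraph.{u, v}}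

/-- The source `s(ξ)`. -/
def source : BoundaryPath Γ → Γ.V
  | fin x _ _ _ _ => x
  | inf ξ _ => Γ.s ξ.head

/-- `ξ₁⋯ξ_{|a|} = a`. -/
def HasInit (a : List Γ.E) : BoundaryPath Γ → Prop
  | fin _ l _ _ _ => a <+: l
  | inf ξ _ => ξ.take a.length = a

theorem HasInit.mono {a c : List Γ.E} {ξ : BoundaryPath Γ} (h : HasInit c ξ) (hac : a <+: c) :
    HasInit a ξ := by
  cases ξ with
  | fin x l y hl hy => exact hac.trans h
  | inf ξ hξ =>
    have h' : ξ.take c.length = c := h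
    change ξ.take a.length = a
    conv_rhs => rw [List.prefix_iff_eq_take.1 hac, ← h', Stream'.take_take, min_eq_right hac.length_le]

theorem HasInit.comparable {a c : List Γ.E} {ξ : BoundaryPath Γ} (ha : HasInit a ξ)
    (hc : HasInit c ξ) : a <+: c ∨ c <+: a := by
  cases ξ with
  | fin x l y hl hy => exact List.prefix_or_prefix_of_prefix ha hc
  | inf ξ hξ =>
    have ha' : ξ.take a.length = a := ha
    have hc' : ξ.take c.length = c := hc
    rcases le_total a.length c.length with h | h
    · left
      rw [List.prefix_iff_eq_take]
      conv_rhs => rw [← hc', Stream'.take_take, min_eq_right h]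
      exact ha'.symm
    · right
      rw [List.prefix_iff_eq_take]
      conv_rhs => rw [← ha', Stream'.take_take, min_eq_right h]
      exact hc'.symm

theorem take_append_self (a : List Γ.E) (ξ : Stream' Γ.E) : (a ++ₛ ξ).take a.length = a := by
  induction a with
  | nil => rfl
  | cons e l ih => exact congrArg (e :: ·) ih

theorem isInfPath_cons {e : Γ.E} {ξ : Stream' Γ.E} :
    Γ.IsInfPath (Stream'.cons e ξ) ↔ Γ.r e = Γ.s ξ.head ∧ Γ.IsInfPath ξ := by
  constructor
  · intro h
    exact ⟨h 0, fun n => h (n + 1)⟩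
  · rintro ⟨h1, h2⟩ n
    cases n with
    | zero => exact h1
    | succ n => exact h2 n

theorem isInfPath_append {x z : Γ.V} {a : List Γ.E} {ξ : Stream' Γ.E} (ha : Γ.IsPath x a z)
    (hz : Γ.s ξ.head = z) (hξ : Γ.IsInfPath ξ) :
    Γ.IsInfPath (a ++ₛ ξ) ∧ Γ.s (a ++ₛ ξ).head = x := by
  induction a generalizing x with
  | nil => exact ⟨hξ, hz.trans (Eq.symm ha)⟩
  | cons e l ih =>
    obtain ⟨h1, h2⟩ := ih ha.2
    exact ⟨isInfPath_cons.2 ⟨h2.symm, h1⟩, ha.1⟩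

theorem isInfPath_drop {x z : Γ.V} {b : List Γ.E} {ξ : Stream' Γ.E} (hb : Γ.IsPath x b z)
    (hx : Γ.s ξ.head = x) (hξ : Γ.IsInfPath ξ) (h : ξ.take b.length = b) :
    Γ.s (ξ.drop b.length).head = z ∧ Γ.IsInfPath (ξ.drop b.length) := by
  induction b generalizing x ξ with
  | nil => exact ⟨hx.trans hb, hξ⟩
  | cons e l ih =>
    have h0 : ξ.head :: ξ.tail.take l.length = e :: l := h
    obtain ⟨h1, h2⟩ := List.cons.inj h0
    have h3 : Γ.r e = Γ.s ξ.tail.head := by rw [← h1]; exact hξ 0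
    exact ih hb.2 h3.symm (fun n => hξ (n + 1)) h2

end BoundaryPath

open BoundaryPath

section SetAction

variable {Γ : DirectedGraph.{u, v}}

/-- The set `X_g`. If `g = a b⁻¹` in reduced form, with `|a| > 0`, then it consists of all
`ξ ∈ X` with initial subpath `a` (whose source is then the source of `g`). If `g = b⁻¹`, then it
consists of all `ξ` whose source is `r(b)`, and if `g` is a vertex `x`, of all `ξ` with source `x`:
in both cases this vertex is the source of `g`. For all other `g` it is empty. -/
def XSet {x y : FreePathGroupoid Γ} (g : x ⟶ y) : Set (BoundaryPath Γ) :=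
  {ξ | ∃ a b, IsFrac g a b ∧ ξ.source = x.vertex ∧ HasInit a ξ}

/-- The map `θ_g : X_{g⁻¹} → X_g`. For `g = a b⁻¹` it replaces the initial subpath `b` by `a`. -/
def theta {x y : FreePathGroupoid Γ} (g : x ⟶ y) : XSet (Groupoid.inv g) → XSet g
  | ⟨.fin _ l t hl ht, h⟩ => ⟨.fin x.vertex (num g ++ l.drop (den g).length) t (by
      obtain ⟨b, a, hf, hs, hi⟩ := h
      have hg : IsFrac g a b := by simpa only [inv_inv'] using hf.inv
      rw [hg.num_eq, hg.den_eq]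
      obtain ⟨z, h1, h2⟩ := hg.exists_isPath
      obtain ⟨l', rfl⟩ := (hi : b <+: l)
      rw [List.drop_left]
      obtain ⟨z', h3, h4⟩ := pathOf_append.1 hl
      have hs' := (hs : _ = y.vertex)
      rw [BoundaryPath.source] at hs'
      subst hs'
      rw [pathOf_end_unique h3 h2] at h4
      exact pathOf_append.2 ⟨z, h1, h4⟩) ht, by
      obtain ⟨b, a, hf, hs, hi⟩ := h
      have hg : IsFrac g a b := by simpa only [inv_inv'] using hf.inv
      refine ⟨a, b, hg, rfl, ?_⟩
      have hn : a <+: num g ++ l.drop (den g).length := by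
        rw [hg.num_eq]
        exact List.prefix_append _ _
      exact hn⟩
  | ⟨.inf ξ hξ, h⟩ =>
    have key : Γ.IsInfPath (num g ++ₛ ξ.drop (den g).length) ∧
        Γ.s (num g ++ₛ ξ.drop (den g).length).head = x.vertex := by
      obtain ⟨b, a, hf, hs, hi⟩ := h
      have hg : IsFrac g a b := by simpa only [inv_inv'] using hf.inv
      rw [hg.num_eq, hg.den_eq]
      obtain ⟨z, h1, h2⟩ := hg.exists_isPath
      obtain ⟨h3, h4⟩ := isInfPath_drop h2 hs hξ hi
      exact isInfPath_append h1 h3 h4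
    ⟨.inf (num g ++ₛ ξ.drop (den g).length) key.1, by
      obtain ⟨b, a, hf, hs, hi⟩ := h
      have hg : IsFrac g a b := by simpa only [inv_inv'] using hf.inv
      refine ⟨a, b, hg, key.2, ?_⟩
      change Stream'.take a.length (num g ++ₛ _) = a
      rw [hg.num_eq, BoundaryPath.take_append_self]⟩

variable (K : Type w) [Field K]

/-- `α_g(f) = f ∘ θ_{g⁻¹}` on `X_g`, extended by zero outside of `X_g`. -/
noncomputable def alpha {x y : FreePathGroupoid Γ} (g : x ⟶ y) (f : BoundaryPath Γ → K) :
    BoundaryPath Γ → K := fun ξ =>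
  if h : ξ ∈ XSet g then f (theta (Groupoid.inv g) ⟨ξ, (inv_inv' g).symm ▸ h⟩) else 0

/-- The characteristic function `1_g` of `X_g`. -/
noncomputable def charFun {x y : FreePathGroupoid Γ} (g : x ⟶ y) : BoundaryPath Γ → K :=
  (XSet g).indicator 1

variable (Γ) in
/-- The set of all characteristic functions `1_g`, for `g` in the free path groupoid. -/
def charFuns : Set (BoundaryPath Γ → K) :=
  {f | ∃ (x y : FreePathGroupoid Γ) (g : x ⟶ y), f = charFun K g}

theorem charFun_mul_mem {x y x' y' : FreePathGroupoid Γ} (g : x ⟶ y) (h : x' ⟶ y') :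
    charFun K g * charFun K h ∈ Submodule.span K (charFuns Γ K) := by
  have hmul : charFun K g * charFun K h = (XSet g ∩ XSet h).indicator 1 := by
    unfold charFun
    rw [Set.inter_indicator_one]
  rcases (XSet g ∩ XSet h).eq_empty_or_nonempty with he | ⟨ξ, h1, h2⟩
  · rw [hmul, he, Set.indicator_empty]
    exact Submodule.zero_mem _
  · obtain ⟨a, b, hg, hs, hi⟩ := h1
    obtain ⟨c, d, hh, hs', hi'⟩ := h2
    have hx : x.vertex = x'.vertex := hs.symm.trans hs'
    rcases hi.comparable hi' with hac | hca
    · have hsub : XSet h ⊆ XSet g := by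
        rintro ζ ⟨c', d', hh', hζ, hi''⟩
        obtain rfl : c' = c := hh'.num_eq.symm.trans hh.num_eq
        exact ⟨a, b, hg, hζ.trans hx.symm, hi''.mono hac⟩
      rw [hmul, Set.inter_eq_right.2 hsub]
      exact Submodule.subset_span ⟨_, _, h, rfl⟩
    · have hsub : XSet g ⊆ XSet h := by
        rintro ζ ⟨a', b', hg', hζ, hi''⟩
        obtain rfl : a' = a := hg'.num_eq.symm.trans hg.num_eq
        exact ⟨c, d, hh, hζ.trans hx, hi''.mono hca⟩
      rw [hmul, Set.inter_eq_left.2 hsub]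
      exact Submodule.subset_span ⟨_, _, g, rfl⟩

variable (Γ) in
/-- The algebra `D(X) = span {1_g : g ∈ G}`, under pointwise operations. -/
def DX : NonUnitalSubalgebra K (BoundaryPath Γ → K) where
  __ := Submodule.span K (charFuns Γ K)
  mul_mem' := by
    intro f f' hf hf'
    change f * f' ∈ Submodule.span K (charFuns Γ K)
    have hf0 : f ∈ Submodule.span K (charFuns Γ K) := hf
    have hf0' : f' ∈ Submodule.span K (charFuns Γ K) := hf'
    induction hf0 using Submodule.span_induction with
    | mem p hp =>
      induction hf0' using Submodule.span_induction with
      | mem q hq =>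
        obtain ⟨_, _, g, rfl⟩ := hp
        obtain ⟨_, _, h, rfl⟩ := hq
        exact charFun_mul_mem K g h
      | zero => rw [mul_zero]; exact Submodule.zero_mem _
      | add q q' hq hq' h1 h2 =>
        rw [mul_add]; exact Submodule.add_mem _ (h1 hq) (h2 hq')
      | smul c q hq h1 =>
        rw [mul_smul_comm]; exact Submodule.smul_mem _ _ (h1 hq)
    | zero => rw [zero_mul]; exact Submodule.zero_mem _
    | add p p' hp hp' h1 h2 =>
      rw [add_mul]; exact Submodule.add_mem _ (h1 hp) (h2 hp')
    | smul c p hp h1 =>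
      rw [smul_mul_assoc]; exact Submodule.smul_mem _ _ (h1 hp)

/-- The element `1_g` of `D(X)`. -/
noncomputable def charElt {x y : FreePathGroupoid Γ} (g : x ⟶ y) : DX Γ K :=
  ⟨charFun K g, Submodule.subset_span ⟨_, _, g, rfl⟩⟩

/-- The ideal `D_g = 1_g D(X)` of `D(X)`. -/
noncomputable def DIdeal {x y : FreePathGroupoid Γ} (g : x ⟶ y) :
    NonUnitalSubalgebra K (DX Γ K) where
  carrier := {f | ∃ k : DX Γ K, f = charElt K g * k}
  zero_mem' := ⟨0, (mul_zero _).symm⟩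
  add_mem' := by
    rintro _ _ ⟨k, rfl⟩ ⟨k', rfl⟩
    exact ⟨k + k', (mul_add _ _ _).symm⟩
  mul_mem' := by
    rintro _ _ ⟨k, rfl⟩ ⟨k', rfl⟩
    exact ⟨k * (charElt K g * k'), mul_assoc _ _ _⟩
  smul_mem' := by
    rintro c _ ⟨k, rfl⟩
    exact ⟨c • k, (mul_smul_comm _ _ _).symm⟩

theorem charElt_mem_DIdeal {x y : FreePathGroupoid Γ} (g : x ⟶ y) : charElt K g ∈ DIdeal K g := by
  refine ⟨charElt K g, Subtype.ext ?_⟩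
  change charFun K g = charFun K g * charFun K g
  unfold charFun
  rw [← Set.inter_indicator_one, Set.inter_self]

end SetAction

/-! ### Partial actions of groupoids on algebras and partial skew groupoid rings -/

/-- A partial action of a groupoid on a `K`-algebra `R` (not necessarily unital). Arrows `g`, `h`
are composable when the range of `g` is the source of `h`, with product `g ≫ h`; the identity
`ε(g)` with `ε(g) g = g` is that of the source of `g`. -/
structure PartialAction (K : Type*) [CommRing K] (C : Type*) [Groupoid C]
    (R : Type*) [NonUnitalRing R] [Module K R] where
  /-- the sets `D_g` -/
  D : ∀ {x y : C}, (x ⟶ y) → NonUnitalSubalgebra K R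
  /-- `D_e` is an ideal of `R` for every identity `e` -/
  ideal_id : ∀ (x : C) (k : R), ∀ a ∈ D (𝟙 x), k * a ∈ D (𝟙 x) ∧ a * k ∈ D (𝟙 x)
  /-- `D_g` is contained in `D_{ε(g)}` -/
  le_id : ∀ {x y : C} (g : x ⟶ y), D g ≤ D (𝟙 x)
  /-- `D_g` is an ideal of `D_{ε(g)}` -/
  ideal : ∀ {x y : C} (g : x ⟶ y), ∀ k ∈ D (𝟙 x), ∀ a ∈ D g, k * a ∈ D g ∧ a * k ∈ D g
  /-- the isomorphisms `α_g : D_{g⁻¹} → D_g` -/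
  act : ∀ {x y : C} (g : x ⟶ y), D (Groupoid.inv g) →ₙₐ[K] D g
  bijective : ∀ {x y : C} (g : x ⟶ y), Function.Bijective (act g)
  /-- `α_e` is the identity of `D_e` -/
  act_id : ∀ (x : C) (a : D (Groupoid.inv (𝟙 x))), (act (𝟙 x) a : R) = a
  /-- `α_h⁻¹(D_{g⁻¹} ∩ D_h) ⊆ D_{(gh)⁻¹}` -/
  mem_comp : ∀ {x y z : C} (g : x ⟶ y) (h : y ⟶ z) (a : D (Groupoid.inv h)),
    (act h a : R) ∈ D (Groupoid.inv g) → (a : R) ∈ D (Groupoid.inv (g ≫ h))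
  /-- `α_g(α_h(a)) = α_{gh}(a)` for all `a ∈ α_h⁻¹(D_{g⁻¹} ∩ D_h)` -/
  act_comp : ∀ {x y z : C} (g : x ⟶ y) (h : y ⟶ z) (a : D (Groupoid.inv h))
    (ha : (act h a : R) ∈ D (Groupoid.inv g)),
    (act g ⟨act h a, ha⟩ : R) = act (g ≫ h) ⟨a, mem_comp g h a ha⟩

namespace PartialAction

variable {K : Type*} [CommRing K] {C : Type*} [Groupoid C]
  {R : Type*} [NonUnitalRing R] [Module K R] (A : PartialAction K C R)

/-- `α_{g⁻¹} : D_g → D_{g⁻¹}`. -/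
def actInv {x y : C} (g : x ⟶ y) : A.D g →ₗ[K] A.D (Groupoid.inv g) where
  toFun a := A.act (Groupoid.inv g) ⟨a, by
    have h : Groupoid.inv (Groupoid.inv g) = g := by simp
    rw [h]; exact a.2⟩
  map_add' a b := map_add (A.act (Groupoid.inv g)) ⟨a, _⟩ ⟨b, _⟩
  map_smul' c a := map_smul (A.act (Groupoid.inv g)) c ⟨a, _⟩

theorem actInv_mul_mem {x y z : C} (g : x ⟶ y) (h : y ⟶ z) (a : A.D g) (b : A.D h) :
    (A.actInv g a : R) * b ∈ A.D (Groupoid.inv g) :=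
  (A.ideal _ _ (A.le_id h b.2) _ (A.actInv g a).2).2

theorem act_mem_comp {x y z : C} (g : x ⟶ y) (h : y ⟶ z) (c : A.D (Groupoid.inv g))
    (hc : (c : R) ∈ A.D h) : (A.act g c : R) ∈ A.D (g ≫ h) := by
  obtain ⟨a, ha⟩ := (A.bijective h).2 ⟨c, hc⟩
  have ha' : (A.act h a : R) = c := congrArg Subtype.val ha
  have hm : (A.act h a : R) ∈ A.D (Groupoid.inv g) := by rw [ha']; exact c.2
  have := A.act_comp g h a hm
  have hce : (⟨A.act h a, hm⟩ : A.D (Groupoid.inv g)) = c := Subtype.ext ha'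
  rw [hce] at this
  rw [this]
  exact (A.act (g ≫ h) _).2

variable [IsScalarTower K R R] [SMulCommClass K R R]

/-- For composable `g` and `h`, the bilinear map `(a, b) ↦ α_g(α_{g⁻¹}(a) b)` from `D_g × D_h` to
`D_{gh}`. -/
def twist {x y z : C} (g : x ⟶ y) (h : y ⟶ z) : A.D g →ₗ[K] A.D h →ₗ[K] A.D (g ≫ h) :=
  LinearMap.mk₂ K
    (fun a b => ⟨A.act g ⟨(A.actInv g a : R) * b, A.actInv_mul_mem g h a b⟩,
      A.act_mem_comp g h _
        (A.ideal h _ (A.le_id (Groupoid.inv g) (A.actInv g a).2) _ b.2).1⟩)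
    (fun a a' b => Subtype.ext (by
      simp only [map_add, NonUnitalSubalgebra.coe_add, add_mul]
      exact congrArg Subtype.val (map_add (A.act g) ⟨(A.actInv g a : R) * b, _⟩ ⟨_, _⟩)))
    (fun c a b => Subtype.ext (by
      simp only [map_smul, NonUnitalSubalgebra.coe_smul, smul_mul_assoc]
      exact congrArg Subtype.val (map_smul (A.act g) c ⟨(A.actInv g a : R) * b, _⟩)))
    (fun a b b' => Subtype.ext (by
      simp only [NonUnitalSubalgebra.coe_add, mul_add]
      exact congrArg Subtype.val (map_add (A.act g) ⟨(A.actInv g a : R) * b, _⟩ ⟨_, _⟩)))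
    (fun c a b => Subtype.ext (by
      simp only [NonUnitalSubalgebra.coe_smul, mul_smul_comm]
      exact congrArg Subtype.val (map_smul (A.act g) c ⟨(A.actInv g a : R) * b, _⟩)))

/-- The partial skew groupoid ring `R ⋊ C`: all finite formal sums `∑ a_g δ_g` with `a_g ∈ D_g`. -/
def SkewRing (A : PartialAction K C R) := ⨁ g : Quiver.Total C, A.D g.hom

noncomputable instance : AddCommGroup A.SkewRing :=
  inferInstanceAs (AddCommGroup (⨁ g : Quiver.Total C, A.D g.hom))

noncomputable instance : Module K A.SkewRing :=
  inferInstanceAs (Module K (⨁ g : Quiver.Total C, A.D g.hom))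

/-- The element `a δ_g`, linear in `a ∈ D_g`. -/
noncomputable def delta {x y : C} (g : x ⟶ y) : A.D g →ₗ[K] A.SkewRing :=
  DirectSum.lof K (Quiver.Total C) (fun g => A.D g.hom) ⟨x, y, g⟩

/-- The product `a δ_g · b δ_h = α_g(α_{g⁻¹}(a) b) δ_{gh}` if `g` and `h` are composable,
and `0` otherwise. -/
noncomputable def deltaMul :
    (g h : Quiver.Total C) → A.D g.hom →ₗ[K] A.D h.hom →ₗ[K] A.SkewRing
  | ⟨_, y, g⟩, ⟨y', _, h⟩ =>
    if e : y = y' then by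
      subst e
      exact (A.twist g h).compr₂ (A.delta (g ≫ h))
    else 0

/-- The bilinear extension of `deltaMul`. -/
noncomputable def mulHom : A.SkewRing →ₗ[K] A.SkewRing →ₗ[K] A.SkewRing :=
  DirectSum.toModule K (Quiver.Total C) (A.SkewRing →ₗ[K] A.SkewRing) fun g =>
    LinearMap.flip (DirectSum.toModule K (Quiver.Total C) (A.D g.hom →ₗ[K] A.SkewRing) fun h =>
      (A.deltaMul g h).flip)

noncomputable instance : NonUnitalNonAssocRing A.SkewRing where
  mul a b := A.mulHom a b
  left_distrib a b c := map_add (A.mulHom a) b c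
  right_distrib a b c := by
    change A.mulHom (a + b) c = A.mulHom a c + A.mulHom b c
    rw [map_add, LinearMap.add_apply]
  zero_mul a := by
    change A.mulHom 0 a = 0
    rw [map_zero, LinearMap.zero_apply]
  mul_zero a := map_zero (A.mulHom a)

theorem mul_eq_deltaMul {x y y' z : C} (g : x ⟶ y) (h : y' ⟶ z) (a : A.D g) (b : A.D h) :
    A.delta g a * A.delta h b = A.deltaMul ⟨x, y, g⟩ ⟨y', z, h⟩ a b := by
  have h1 : A.mulHom (A.delta g a) = _ :=
    DirectSum.toModule_lof K (M := fun g : Quiver.Total C => A.D g.hom) ⟨x, y, g⟩ a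
  change A.mulHom (A.delta g a) (A.delta h b) = _
  rw [h1]
  have h2 := DirectSum.toModule_lof K (M := fun g : Quiver.Total C => A.D g.hom)
    (φ := fun h => (A.deltaMul ⟨x, y, g⟩ h).flip) ⟨y', z, h⟩ b
  exact LinearMap.congr_fun h2 a

theorem delta_mul_delta {x y z : C} (g : x ⟶ y) (h : y ⟶ z) (a : A.D g) (b : A.D h) :
    A.delta g a * A.delta h b = A.delta (g ≫ h) (A.twist g h a b) := by
  rw [mul_eq_deltaMul, deltaMul, dif_pos rfl]
  rfl

theorem delta_mul_delta_of_ne {x y y' z : C} (hy : y ≠ y') (g : x ⟶ y) (h : y' ⟶ z)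
    (a : A.D g) (b : A.D h) : A.delta g a * A.delta h b = 0 := by
  rw [mul_eq_deltaMul, deltaMul, dif_neg hy]
  rfl

end PartialAction

/-! ### The Leavitt path algebra -/

/-- The generators `v`, `e`, `e*` of the Leavitt path algebra. -/
inductive LeavittGen (Γ : DirectedGraph.{u, v}) : Type (max u v)
  | vertex (x : Γ.V)
  | edge (e : Γ.E)
  | ghost (e : Γ.E)

/-- The free (non-unital, associative) `K`-algebra on the generators of the Leavitt path algebra:
its basis consists of the nonempty words in the generators. -/
abbrev LeavittFree (Γ : DirectedGraph.{u, v}) (K : Type w) [Field K] :=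
  K[FreeSemigroup (LeavittGen Γ)]

namespace LeavittFree

variable {Γ : DirectedGraph.{u, v}} (K : Type w) [Field K]

/-- A generator, as an element of the free algebra. -/
noncomputable def gen (t : LeavittGen Γ) : LeavittFree Γ K :=
  MonoidAlgebra.single (FreeSemigroup.of t) 1

noncomputable def vertex (x : Γ.V) : LeavittFree Γ K := gen K (.vertex x)

noncomputable def edge (e : Γ.E) : LeavittFree Γ K := gen K (.edge e)

noncomputable def ghost (e : Γ.E) : LeavittFree Γ K := gen K (.ghost e)

end LeavittFree

open LeavittFree in
/-- The defining relations of the Leavitt path algebra, and their scalar multiples. -/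
inductive LeavittRel (Γ : DirectedGraph.{u, v}) (K : Type w) [Field K] :
    LeavittFree Γ K → LeavittFree Γ K → Prop
  | vertex_mul_self (x : Γ.V) : LeavittRel Γ K (vertex K x * vertex K x) (vertex K x)
  | vertex_mul_of_ne (x y : Γ.V) : x ≠ y → LeavittRel Γ K (vertex K x * vertex K y) 0
  | source_mul_edge (e : Γ.E) : LeavittRel Γ K (vertex K (Γ.s e) * edge K e) (edge K e)
  | edge_mul_range (e : Γ.E) : LeavittRel Γ K (edge K e * vertex K (Γ.r e)) (edge K e)
  | range_mul_ghost (e : Γ.E) : LeavittRel Γ K (vertex K (Γ.r e) * ghost K e) (ghost K e)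
  | ghost_mul_source (e : Γ.E) : LeavittRel Γ K (ghost K e * vertex K (Γ.s e)) (ghost K e)
  | ghost_mul_self (e : Γ.E) : LeavittRel Γ K (ghost K e * edge K e) (vertex K (Γ.r e))
  | ghost_mul_of_ne (e f : Γ.E) : e ≠ f → LeavittRel Γ K (ghost K e * edge K f) 0
  | cuntzKrieger (x : Γ.V) (hfin : {e : Γ.E | Γ.s e = x}.Finite) :
      {e : Γ.E | Γ.s e = x}.Nonempty →
      LeavittRel Γ K (vertex K x) (∑ e ∈ hfin.toFinset, edge K e * ghost K e)
  | smul (c : K) (a b : LeavittFree Γ K) : LeavittRel Γ K a b → LeavittRel Γ K (c • a) (c • b)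

/-- The Leavitt path algebra `L_K(Γ)`: the universal (associative, not necessarily unital)
`K`-algebra on the generators `v`, `e`, `e*` subject to the defining relations. -/
def LeavittPathAlgebra (Γ : DirectedGraph.{u, v}) (K : Type w) [Field K] :=
  (ringConGen (LeavittRel Γ K)).Quotient

namespace LeavittPathAlgebra

variable {Γ : DirectedGraph.{u, v}} {K : Type w} [Field K]

noncomputable instance : NonUnitalRing (LeavittPathAlgebra Γ K) :=
  inferInstanceAs (NonUnitalRing (ringConGen (LeavittRel Γ K)).Quotient)

/-- The quotient map from the free algebra. -/
noncomputable def mk (a : LeavittFree Γ K) : LeavittPathAlgebra Γ K :=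
  RingCon.toQuotient (c := ringConGen (LeavittRel Γ K)) a

theorem rel_smul (c : K) {a b : LeavittFree Γ K} (h : ringConGen (LeavittRel Γ K) a b) :
    ringConGen (LeavittRel Γ K) (c • a) (c • b) := by
  have h' : RingConGen.Rel (LeavittRel Γ K) a b := h
  change RingConGen.Rel (LeavittRel Γ K) (c • a) (c • b)
  induction h' with
  | of a b hab => exact .of _ _ (.smul c a b hab)
  | refl a => exact .refl _
  | symm hab ih => exact .symm (ih hab)
  | trans hab hbd ih ih' => exact .trans (ih hab) (ih' hbd)
  | add hab hbd ih ih' =>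
    rw [smul_add, smul_add]; exact .add (ih hab) (ih' hbd)
  | mul hab hbd ih _ =>
    rw [← smul_mul_assoc, ← smul_mul_assoc]; exact .mul (ih hab) hbd

noncomputable instance : SMul K (LeavittPathAlgebra Γ K) where
  smul c := Quotient.map' (c • ·) fun _ _ h => rel_smul c h

theorem mk_surjective : Function.Surjective (mk : LeavittFree Γ K → LeavittPathAlgebra Γ K) :=
  Quotient.mk''_surjective

noncomputable instance : Module K (LeavittPathAlgebra Γ K) :=
  Function.Surjective.module K
    (⟨⟨mk, rfl⟩, fun _ _ => rfl⟩ : LeavittFree Γ K →+ LeavittPathAlgebra Γ K)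
    mk_surjective fun _ _ => rfl

/-- The generator `v`. -/
noncomputable def vertex (K : Type w) [Field K] (x : Γ.V) : LeavittPathAlgebra Γ K :=
  mk (LeavittFree.vertex K x)

/-- The generator `e`. -/
noncomputable def edge (K : Type w) [Field K] (e : Γ.E) : LeavittPathAlgebra Γ K :=
  mk (LeavittFree.edge K e)

/-- The generator `e*`. -/
noncomputable def ghost (K : Type w) [Field K] (e : Γ.E) : LeavittPathAlgebra Γ K :=
  mk (LeavittFree.ghost K e)

end LeavittPathAlgebra

/-!
The proof compares both algebras through elements indexed by pairs of finite paths `a`, `b` with the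
same range. In the Leavitt path algebra these are the elements `a b*`. In the skew ring they are the
elements `fracDelta`, that is `1_a δ_g` where `g` is the reduced form of `a b⁻¹`.

The maps `θ_g` are handled through the relation `Act g ξ η`, saying that `ξ = θ_g(η)`: here `ξ = aζ`
and `η = bζ` for some `ζ` and some expression `g = a b⁻¹`, reduced or not. Admitting expressions that
are not reduced makes the relation compatible with products (`Act.comp`), while cancelling a common
final segment (`exists_isFrac_of_toGroup_eq`) gives back the reduced form. The axioms of a partial
action (`pathAction`), the product formula `(a δ_g · b δ_h)(ξ) = a(ξ) b(θ_{g⁻¹}(ξ))`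
(`delta_mul_delta_eq`) and the associativity of the skew ring follow pointwise.

The elements `fracDelta` multiply like the elements `a b*`, so they satisfy the relations of the
Leavitt path algebra and define the homomorphism `toSkewRing`, with `a b* ↦ 1_a δ_{a b⁻¹}`. It is
surjective because, for `g = a b⁻¹` in reduced form, `D_g` is spanned by the functions `1_{at}`
(`mem_span_of_mem_DIdeal`), and `1_{at} δ_g` is the image of `(at)(bt)*`.

For injectivity a left inverse is constructed. Every linear relation between the functions `1_c` also
holds between the projections `cc*` (`linearCombination_cylProj_eq_zero`): the paths are split
according to their first edge, and a constant term is distributed over the edges leaving the vertex by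
the Cuntz-Krieger relation if the vertex is regular. It vanishes otherwise, as some boundary path then
avoids all the other cylinders. Hence `1_c ↦ cc*` extends to a linear map `π`, and
`f δ_g ↦ π(f) a b*`, with `g = a b⁻¹` in reduced form, sends `1_{at} δ_g` back to
`(at)(at)* a b* = (at)(bt)*`. As the elements `a b*` span the Leavitt path algebra
(`mem_span_path_mul_ghostPath`), this is a left inverse.
-/

/-! ### Concatenation of a finite path and a boundary path -/

namespace BoundaryPath

variable {Γ : DirectedGraph.{u, v}} {a b : List Γ.E} {η η' ξ ξ' : BoundaryPath Γ}

/-- `Concat a η ξ` says that `a` is a path ending at the source of `η` and that `ξ = aη`. -/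
def Concat (a : List Γ.E) : BoundaryPath Γ → BoundaryPath Γ → Prop
  | fin x l y _ _, fin x' l' y' _ _ => Γ.IsPath x' a x ∧ l' = a ++ l ∧ y' = y
  | inf η _, inf ξ _ => Γ.IsPath (Γ.s ξ.head) a (Γ.s η.head) ∧ ξ = a ++ₛ η
  | _, _ => False

theorem Concat.isPath (h : Concat a η ξ) : Γ.IsPath ξ.source a η.source := by
  cases η <;> cases ξ
  · exact h.1
  · exact h.elim
  · exact h.elim
  · exact h.1

theorem Concat.hasInit (h : Concat a η ξ) : HasInit a ξ := by
  cases η <;> cases ξ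
  · exact ⟨_, h.2.1.symm⟩
  · exact h.elim
  · exact h.elim
  · obtain ⟨-, h⟩ := h
    subst h
    exact take_append_self _ _

theorem isPath_take {ξ : Stream' Γ.E} (h : Γ.IsInfPath ξ) (n : ℕ) :
    Γ.IsPath (Γ.s ξ.head) (ξ.take n) (Γ.s (ξ.drop n).head) := by
  induction n generalizing ξ with
  | zero => rfl
  | succ n ih =>
    refine ⟨rfl, ?_⟩
    have h0 : Γ.r ξ.head = Γ.s ξ.tail.head := h 0
    change PathOf Γ.s Γ.r (Γ.r ξ.head) (ξ.tail.take n) _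
    rw [h0]
    exact ih fun n => h (n + 1)

theorem HasInit.exists_concat (h : HasInit a ξ) : ∃ η, Concat a η ξ := by
  cases ξ with
  | fin x l y hl hy =>
    obtain ⟨l', rfl⟩ := (h : a <+: l)
    obtain ⟨z, h1, h2⟩ := pathOf_append.1 hl
    exact ⟨fin z l' y h2 hy, h1, rfl, rfl⟩
  | inf ξ hξ =>
    have h' : ξ.take a.length = a := h
    refine ⟨inf (ξ.drop a.length) ?_, ?_, ?_⟩
    · exact (isInfPath_drop (by have := isPath_take hξ a.length; rwa [h'] at this) rfl hξ h').2
    · have := isPath_take hξ a.length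
      rwa [h'] at this
    · conv_lhs => rw [← Stream'.append_take_drop a.length ξ, h']

theorem hasInit_iff : HasInit a ξ ↔ ∃ η, Concat a η ξ :=
  ⟨HasInit.exists_concat, fun ⟨_, h⟩ => h.hasInit⟩

theorem exists_concat {x : Γ.V} (h : Γ.IsPath x a η.source) :
    ∃ ξ, Concat a η ξ ∧ ξ.source = x := by
  cases η with
  | fin z l y hl hy =>
    exact ⟨fin x (a ++ l) y (pathOf_append.2 ⟨z, h, hl⟩) hy, ⟨h, rfl, rfl⟩, rfl⟩
  | inf η hη =>
    obtain ⟨h1, h2⟩ := isInfPath_append h rfl hη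
    refine ⟨inf (a ++ₛ η) h1, ⟨?_, rfl⟩, h2⟩
    rw [h2]
    exact h

theorem Concat.left_unique (h : Concat a η ξ) (h' : Concat a η' ξ) : η = η' := by
  cases η <;> cases ξ <;> cases η' <;> try exact h.elim
  · obtain ⟨h1, h2, h3⟩ := h
    obtain ⟨h1', h2', h3'⟩ := h'
    obtain rfl := pathOf_end_unique h1 h1'
    obtain rfl := List.append_cancel_left (h2.symm.trans h2')
    subst h3
    subst h3'
    rfl
  · exact h'.elim
  · exact h'.elim
  · obtain rfl := Stream'.append_right_injective _ _ _ (h.2.symm.trans h'.2)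
    rfl

theorem Concat.right_unique (h : Concat a η ξ) (h' : Concat a η ξ')
    (hs : ξ.source = ξ'.source) : ξ = ξ' := by
  cases η <;> cases ξ <;> cases ξ' <;> try exact h.elim
  · obtain ⟨h1, h2, h3⟩ := h
    obtain ⟨h1', h2', h3'⟩ := h'
    simp only [source] at hs
    subst hs h2 h2' h3 h3'
    rfl
  · exact h'.elim
  · exact h'.elim
  · obtain ⟨-, h⟩ := h
    obtain ⟨-, h'⟩ := h'
    subst h h'
    rfl

theorem concat_nil : Concat [] η ξ ↔ η = ξ := by
  constructor
  · intro h
    cases η <;> cases ξ <;> try exact h.elim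
    · obtain ⟨h1, h2, h3⟩ := h
      simp only [PathOf, List.nil_append] at h1 h2
      subst h1 h2 h3
      rfl
    · obtain ⟨-, h⟩ := h
      simp only [Stream'.nil_append_stream] at h
      subst h
      rfl
  · rintro rfl
    cases η
    · exact ⟨rfl, rfl, rfl⟩
    · exact ⟨rfl, rfl⟩

theorem Concat.append {ζ : BoundaryPath Γ} (h : Concat a ζ ξ) (h' : Concat b η ζ) :
    Concat (a ++ b) η ξ := by
  cases η <;> cases ζ <;> cases ξ <;> try first | exact h.elim | exact h'.elim
  · exact ⟨pathOf_append.2 ⟨_, h.1, h'.1⟩, by rw [h.2.1, h'.2.1, List.append_assoc],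
      h.2.2.trans h'.2.2⟩
  · exact ⟨pathOf_append.2 ⟨_, h.1, h'.1⟩, by
      rw [h.2, h'.2, Stream'.append_append_stream]⟩

theorem Concat.exists_of_append (h : Concat (a ++ b) η ξ) :
    ∃ ζ, Concat a ζ ξ ∧ Concat b η ζ := by
  obtain ⟨z, h1, h2⟩ := pathOf_append.1 h.isPath
  obtain ⟨ζ, h3, rfl⟩ := exists_concat h2
  obtain ⟨ξ', h4, h5⟩ := exists_concat h1
  obtain rfl : ξ' = ξ := (h4.append h3).right_unique h h5
  exact ⟨ζ, h4, h3⟩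

theorem hasInit_append_iff (h : Concat a η ξ) : HasInit (a ++ b) ξ ↔ HasInit b η := by
  rw [hasInit_iff, hasInit_iff]
  constructor
  · rintro ⟨ζ, hζ⟩
    obtain ⟨μ, h1, h2⟩ := hζ.exists_of_append
    obtain rfl := h1.left_unique h
    exact ⟨ζ, h2⟩
  · rintro ⟨ζ, hζ⟩
    exact ⟨ζ, h.append hζ⟩

end BoundaryPath

/-! ### The partial action on boundary paths as a relation -/

namespace FreePathGroupoid

variable {Γ : DirectedGraph.{u, v}}

/-- The product of the edges of `a` in the free group on all edges. -/
def posGroup (a : List Γ.E) : FreeGroup Γ.E := FreeGroup.mk (Γ.pos a)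

/-- The element of the free group on the edges given by the word of `g`. -/
def toGroup {x y : FreePathGroupoid Γ} (g : x ⟶ y) : FreeGroup Γ.E := FreeGroup.mk (word g)

theorem posGroup_append (a b : List Γ.E) : posGroup (a ++ b) = posGroup a * posGroup b := by
  simp [posGroup, pos, FreeGroup.mul_mk]

@[simp]
theorem posGroup_nil : posGroup ([] : List Γ.E) = 1 := rfl

theorem mk_neg (b : List Γ.E) : FreeGroup.mk (Γ.neg b) = (posGroup b)⁻¹ := by
  simp [posGroup, FreeGroup.inv_mk, FreeGroup.invRev, pos, neg, Function.comp_def]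

theorem isReduced_word {x y : FreePathGroupoid Γ} (g : x ⟶ y) :
    FreeGroup.IsReduced (word g) := Arr.isReduced g

theorem toGroup_injective {x y : FreePathGroupoid Γ} {g h : x ⟶ y}
    (H : toGroup g = toGroup h) : g = h := by
  refine Arr.ext' ?_
  have := congrArg FreeGroup.toWord H
  simp only [toGroup, FreeGroup.toWord_mk] at this
  rw [(isReduced_word g).reduce_eq, (isReduced_word h).reduce_eq] at this
  exact this

theorem toGroup_comp {x y z : FreePathGroupoid Γ} (g : x ⟶ y) (h : y ⟶ z) :
    toGroup (g ≫ h) = toGroup g * toGroup h := by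
  change FreeGroup.mk (FreeGroup.reduce (word g ++ word h)) = _
  rw [FreeGroup.reduce.self, ← FreeGroup.mul_mk]
  rfl

theorem toGroup_inv {x y : FreePathGroupoid Γ} (g : x ⟶ y) :
    toGroup (Groupoid.inv g) = (toGroup g)⁻¹ := by
  rw [toGroup, word_inv, toGroup, FreeGroup.inv_mk]

@[simp]
theorem toGroup_id (x : FreePathGroupoid Γ) : toGroup (𝟙 x) = 1 := rfl

theorem IsFrac.toGroup_eq {x y : FreePathGroupoid Γ} {g : x ⟶ y} {a b : List Γ.E}
    (h : IsFrac g a b) : toGroup g = posGroup a * (posGroup b)⁻¹ := by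
  rw [toGroup, h, ← FreeGroup.mul_mk, mk_neg]
  rfl

theorem isReduced_of_forall_snd {L : List Γ.Letter} {t : Bool} (h : ∀ l ∈ L, l.2 = t) :
    FreeGroup.IsReduced L := by
  induction L with
  | nil => exact .nil
  | cons l L ih =>
    refine List.isChain_cons.2 ⟨fun l' hl' _ => ?_, ih fun l' hl' => h l' (.tail _ hl')⟩
    rw [h l (by simp), h l' (.tail _ (List.mem_of_mem_head? hl'))]

theorem isReduced_pos_append_neg {a b : List Γ.E}
    (h : ∀ e ∈ a.getLast?, e ∉ b.getLast?) : FreeGroup.IsReduced (Γ.pos a ++ Γ.neg b) := by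
  refine List.isChain_append.2 ⟨isReduced_of_forall_snd (t := true) ?_,
    isReduced_of_forall_snd (t := false) ?_, ?_⟩
  · simp [pos]
  · simp [neg]
  · intro l hl l' hl' hll'
    simp only [pos, neg, List.getLast?_map, List.head?_reverse, Option.mem_def,
      Option.map_eq_some_iff] at hl hl'
    obtain ⟨e, he, rfl⟩ := hl
    obtain ⟨f, hf, rfl⟩ := hl'
    obtain rfl : e = f := hll'
    exact (h e he hf).elim

theorem isFrac_of_isReduced {x y : FreePathGroupoid Γ} {g : x ⟶ y} {a b : List Γ.E}
    (hr : FreeGroup.IsReduced (Γ.pos a ++ Γ.neg b))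
    (h : toGroup g = posGroup a * (posGroup b)⁻¹) : IsFrac g a b := by
  have := congrArg FreeGroup.toWord h
  rw [← mk_neg, posGroup, FreeGroup.mul_mk, toGroup, FreeGroup.toWord_mk, FreeGroup.toWord_mk,
    (isReduced_word g).reduce_eq, hr.reduce_eq] at this
  exact this

/-- Cancelling the longest common final segment `c` of two paths brings `a b⁻¹` into reduced
form. -/
theorem exists_isFrac_of_toGroup_eq {x y : FreePathGroupoid Γ} {g : x ⟶ y} {a b : List Γ.E}
    (h : toGroup g = posGroup a * (posGroup b)⁻¹) :
    ∃ a₀ b₀ c, IsFrac g a₀ b₀ ∧ a = a₀ ++ c ∧ b = b₀ ++ c := by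
  induction a using List.reverseRecOn generalizing b with
  | nil =>
    exact ⟨[], b, [], isFrac_of_isReduced (isReduced_pos_append_neg (by simp)) h, rfl, by simp⟩
  | append_singleton a e ih =>
    rcases List.eq_nil_or_concat b with rfl | ⟨b, f, rfl⟩
    · exact ⟨a ++ [e], [], [], isFrac_of_isReduced (isReduced_pos_append_neg (by simp)) h,
        by simp, rfl⟩
    rw [List.concat_eq_append] at h ⊢
    by_cases hef : f = e
    · subst hef
      rw [posGroup_append, posGroup_append, mul_inv_rev, mul_assoc, mul_inv_cancel_left] at h
      obtain ⟨a₀, b₀, c, hg, rfl, rfl⟩ := ih h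
      exact ⟨a₀, b₀, c ++ [f], hg, by simp, by simp⟩
    · refine ⟨a ++ [e], b ++ [f], [], isFrac_of_isReduced (isReduced_pos_append_neg ?_) h,
        by simp, by simp⟩
      simpa using hef

/-- `Act g ξ η` says that `θ_g` is defined at `η`, with value `ξ`: there are paths `a`, `b` with
`g = a b⁻¹`, not necessarily in reduced form, such that `ξ = aζ` and `η = bζ` for some `ζ`. -/
def Act {x y : FreePathGroupoid Γ} (g : x ⟶ y) (ξ η : BoundaryPath Γ) : Prop :=
  ∃ a b ζ, toGroup g = posGroup a * (posGroup b)⁻¹ ∧ Concat a ζ ξ ∧ Concat b ζ η ∧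
    ξ.source = x.vertex ∧ η.source = y.vertex

variable {x y z : FreePathGroupoid Γ} {g : x ⟶ y} {ξ ξ' η η' ζ : BoundaryPath Γ}

theorem Act.exists_isFrac (h : Act g ξ η) : ∃ a b ζ, IsFrac g a b ∧ Concat a ζ ξ ∧
    Concat b ζ η ∧ ξ.source = x.vertex ∧ η.source = y.vertex := by
  obtain ⟨a, b, ζ, hg, h1, h2, h3, h4⟩ := h
  obtain ⟨a₀, b₀, c, hg', rfl, rfl⟩ := exists_isFrac_of_toGroup_eq hg
  obtain ⟨μ, hμ, hc⟩ := h1.exists_of_append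
  obtain ⟨μ', hμ', hc'⟩ := h2.exists_of_append
  obtain rfl : μ = μ' := by
    refine hc.right_unique hc' ?_
    obtain ⟨t, ht, ht'⟩ := hg'.exists_isPath
    have e1 := hμ.isPath
    have e2 := hμ'.isPath
    rw [h3] at e1
    rw [h4] at e2
    exact (pathOf_end_unique e1 ht).trans (pathOf_end_unique ht' e2)
  exact ⟨a₀, b₀, μ, hg', hμ, hμ', h3, h4⟩

theorem Act.source_left (h : Act g ξ η) : ξ.source = x.vertex := by
  obtain ⟨a, b, ζ, hg, h1, h2, h3, h4⟩ := h
  exact h3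

theorem Act.inv (h : Act g ξ η) : Act (Groupoid.inv g) η ξ := by
  obtain ⟨a, b, ζ, hg, h1, h2, h3, h4⟩ := h
  exact ⟨b, a, ζ, by rw [toGroup_inv, hg]; group, h2, h1, h4, h3⟩

theorem act_inv_iff : Act (Groupoid.inv g) η ξ ↔ Act g ξ η :=
  ⟨fun h => by simpa only [inv_inv'] using h.inv, Act.inv⟩

theorem Act.left_unique (h : Act g ξ η) (h' : Act g ξ' η) : ξ = ξ' := by
  obtain ⟨a, b, ζ, hg, h1, h2, h3, h4⟩ := h.exists_isFrac
  obtain ⟨a', b', ζ', hg', h1', h2', h3', h4'⟩ := h'.exists_isFrac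
  obtain rfl := hg.num_eq.symm.trans hg'.num_eq
  obtain rfl := hg.den_eq.symm.trans hg'.den_eq
  obtain rfl := h2.left_unique h2'
  exact h1.right_unique h1' (h3.trans h3'.symm)

theorem Act.right_unique (h : Act g ξ η) (h' : Act g ξ η') : η = η' :=
  h.inv.left_unique h'.inv

theorem act_id_iff : Act (𝟙 x) ξ η ↔ ξ = η ∧ ξ.source = x.vertex := by
  constructor
  · intro h
    obtain ⟨a, b, ζ, hg, h1, h2, h3, h4⟩ := h.exists_isFrac
    obtain ⟨rfl, h0⟩ := List.append_eq_nil_iff.1 (hg.symm.trans rfl : Γ.pos a ++ Γ.neg b = [])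
      |>.imp_left (List.map_eq_nil_iff.1)
    obtain rfl : b = [] := by simpa [neg] using h0
    exact ⟨(concat_nil.1 h1).symm.trans (concat_nil.1 h2), h3⟩
  · rintro ⟨rfl, h⟩
    exact ⟨[], [], ξ, by simp, concat_nil.2 rfl, concat_nil.2 rfl, h, h⟩

/-- For `g = a b⁻¹` and `h = c d⁻¹` with `θ_h(dν) = cν = bμ` and `θ_g(bμ) = aμ`, one of `b` and `c`
is an initial segment of the other; the difference is moved to the other side. -/
theorem Act.comp {h : y ⟶ z} (H : Act g ξ η) (H' : Act h η ζ) : Act (g ≫ h) ξ ζ := by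
  obtain ⟨a, b, μ, hg, h1, h2, h3, h4⟩ := H
  obtain ⟨c, d, ν, hh, h1', h2', h3', h4'⟩ := H'
  rcases h2.hasInit.comparable h1'.hasInit with ⟨t, rfl⟩ | ⟨t, rfl⟩
  · obtain ⟨μ', hμ, hν⟩ := h1'.exists_of_append
    obtain rfl := hμ.left_unique h2
    exact ⟨a ++ t, d, ν, by rw [toGroup_comp, hg, hh, posGroup_append, posGroup_append]; group,
      h1.append hν, h2', h3, h4'⟩
  · obtain ⟨ν', hν, hμ⟩ := h2.exists_of_append
    obtain rfl := hν.left_unique h1'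
    exact ⟨a, d ++ t, μ, by rw [toGroup_comp, hg, hh, posGroup_append, posGroup_append]; group,
      h1, h2'.append hμ, h3, h4'⟩

theorem mem_XSet_iff : ξ ∈ XSet g ↔ ∃ η, Act g ξ η := by
  constructor
  · rintro ⟨a, b, hg, hs, hi⟩
    obtain ⟨ζ, hζ⟩ := hi.exists_concat
    obtain ⟨t, h1, h2⟩ := hg.exists_isPath
    have h3 := hζ.isPath
    rw [hs] at h3
    obtain rfl := pathOf_end_unique h3 h1
    obtain ⟨η, hη, hη'⟩ := exists_concat h2
    exact ⟨η, a, b, ζ, hg.toGroup_eq, hζ, hη, hs, hη'⟩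
  · rintro ⟨η, h⟩
    obtain ⟨a, b, ζ, hg, h1, h2, h3, h4⟩ := h.exists_isFrac
    exact ⟨a, b, hg, h3, h1.hasInit⟩

theorem Act.mem_XSet (h : Act g ξ η) : ξ ∈ XSet g := mem_XSet_iff.2 ⟨η, h⟩

theorem Act.mem_XSet_inv (h : Act g ξ η) : η ∈ XSet (Groupoid.inv g) := h.inv.mem_XSet

theorem act_theta (η : XSet (Groupoid.inv g)) : Act g (theta g η) η := by
  obtain ⟨η, hη⟩ := η
  obtain ⟨ξ, hξ⟩ := mem_XSet_iff.1 hη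
  rw [act_inv_iff] at hξ
  obtain ⟨a, b, ζ, hg, h1, h2, h3, h4⟩ := hξ.exists_isFrac
  suffices ξ = theta g ⟨η, hη⟩ from this ▸ hξ
  cases η with
  | fin y' l t hl ht =>
    cases ζ with
    | inf => exact h2.elim
    | fin =>
      cases ξ with
      | inf => exact h1.elim
      | fin =>
        obtain ⟨p1, p2, p3⟩ := h1
        obtain ⟨q1, q2, q3⟩ := h2
        subst p2 q2 p3 q3
        have h3' := (h3 : _ = x.vertex)
        simp only [source] at h3'
        subst h3'
        simp only [theta, hg.num_eq, hg.den_eq, List.drop_left]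
        rfl
  | inf η hη' =>
    cases ζ with
    | fin => exact h2.elim
    | inf =>
      cases ξ with
      | fin => exact h1.elim
      | inf =>
        obtain ⟨p1, p2⟩ := h1
        obtain ⟨q1, q2⟩ := h2
        subst p2 q2
        simp only [theta, hg.num_eq, hg.den_eq, Stream'.drop_append_stream]

end FreePathGroupoid

section Alpha

variable {Γ : DirectedGraph.{u, v}} (K : Type w) [Field K] {x y z : FreePathGroupoid Γ}
  {g : x ⟶ y} {ξ η : BoundaryPath Γ}

theorem alpha_apply_of_act (h : Act g ξ η) (f : BoundaryPath Γ → K) : alpha K g f ξ = f η := by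
  rw [alpha, dif_pos h.mem_XSet]
  congr 1
  exact (act_inv_iff.1 (act_theta (g := Groupoid.inv g) ⟨ξ, _⟩)).right_unique h

theorem alpha_apply_of_notMem (h : ξ ∉ XSet g) (f : BoundaryPath Γ → K) : alpha K g f ξ = 0 :=
  dif_neg h

end Alpha

/-! ### Cylinder functions -/

namespace FreePathGroupoid

variable {Γ : DirectedGraph.{u, v}}

/-- The arrow `a b⁻¹`, brought into reduced form, for paths `a` and `b` with the same range. -/
noncomputable def frac {x y : FreePathGroupoid Γ} {z : Γ.V} {a b : List Γ.E}
    (ha : Γ.IsPath x.vertex a z) (hb : Γ.IsPath y.vertex b z) : x ⟶ y :=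
  (⟨FreeGroup.reduce (Γ.pos a ++ Γ.neg b),
    isWalk_of_red FreeGroup.reduce.red
      (pathOf_append.2 ⟨z, isWalk_pos.2 ha, isWalk_neg.2 hb⟩),
    FreeGroup.isReduced_iff_reduce_eq.2 FreeGroup.reduce.idem⟩ : Arr _ _)

theorem toGroup_frac {x y : FreePathGroupoid Γ} {z : Γ.V} {a b : List Γ.E}
    (ha : Γ.IsPath x.vertex a z) (hb : Γ.IsPath y.vertex b z) :
    toGroup (frac ha hb) = posGroup a * (posGroup b)⁻¹ := by
  change FreeGroup.mk (FreeGroup.reduce (Γ.pos a ++ Γ.neg b)) = _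
  rw [FreeGroup.reduce.self, ← FreeGroup.mul_mk, mk_neg]
  rfl

end FreePathGroupoid

section Cylinder

variable {Γ : DirectedGraph.{u, v}}

/-- The set of all boundary paths with source `x` and initial segment `c`. It is empty if `c` is
not a path starting at `x`. -/
def cylSet (x : Γ.V) (c : List Γ.E) : Set (BoundaryPath Γ) :=
  {ξ | ξ.source = x ∧ HasInit c ξ}

theorem hasInit_nil (ξ : BoundaryPath Γ) : HasInit [] ξ :=
  (concat_nil.2 rfl : Concat [] ξ ξ).hasInit

theorem exists_isPath_of_mem_cylSet {x : Γ.V} {c : List Γ.E} {ξ : BoundaryPath Γ}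
    (h : ξ ∈ cylSet x c) : ∃ z, Γ.IsPath x c z := by
  obtain ⟨η, hη⟩ := h.2.exists_concat
  exact ⟨_, h.1 ▸ hη.isPath⟩

theorem FreePathGroupoid.IsFrac.XSet_eq {x y : FreePathGroupoid Γ} {g : x ⟶ y}
    {a b : List Γ.E} (h : IsFrac g a b) : XSet g = cylSet x.vertex a := by
  ext ξ
  constructor
  · rintro ⟨a', b', h', hs, hi⟩
    obtain rfl := h'.num_eq.symm.trans h.num_eq
    exact ⟨hs, hi⟩
  · rintro ⟨hs, hi⟩
    exact ⟨a, b, h, hs, hi⟩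

theorem XSet_eq_empty {x y : FreePathGroupoid Γ} {g : x ⟶ y} (h : ¬ ∃ a b, IsFrac g a b) :
    XSet g = ∅ := by
  refine Set.eq_empty_of_forall_notMem ?_
  rintro ξ ⟨a, b, hg, -⟩
  exact h ⟨a, b, hg⟩

variable (K : Type w) [Field K]

/-- The characteristic function of `cylSet x c`. -/
noncomputable def cylFun (x : Γ.V) (c : List Γ.E) : BoundaryPath Γ → K :=
  (cylSet x c).indicator 1

variable {K}

theorem cylFun_eq_one {x : Γ.V} {c : List Γ.E} {ξ : BoundaryPath Γ} (hs : ξ.source = x)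
    (h : HasInit c ξ) : cylFun K x c ξ = 1 := by
  rw [cylFun, Set.indicator_of_mem (show ξ ∈ cylSet x c from ⟨hs, h⟩), Pi.one_apply]

theorem cylFun_eq_zero {x : Γ.V} {c : List Γ.E} {ξ : BoundaryPath Γ}
    (h : ξ.source = x → ¬ HasInit c ξ) : cylFun K x c ξ = 0 :=
  Set.indicator_of_notMem (fun h' => h h'.1 h'.2) _

theorem cylFun_congr {x x' : Γ.V} {c c' : List Γ.E} {ξ ξ' : BoundaryPath Γ}
    (h : ξ ∈ cylSet x c ↔ ξ' ∈ cylSet x' c') : cylFun K x c ξ = cylFun K x' c' ξ' := by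
  by_cases h' : ξ ∈ cylSet x c
  · rw [cylFun_eq_one h'.1 h'.2, cylFun_eq_one (h.1 h').1 (h.1 h').2]
  · rw [cylFun_eq_zero fun h1 h2 => h' ⟨h1, h2⟩,
      cylFun_eq_zero fun h1 h2 => h' (h.2 ⟨h1, h2⟩)]

theorem FreePathGroupoid.IsFrac.charFun_eq {x y : FreePathGroupoid Γ} {g : x ⟶ y}
    {a b : List Γ.E} (h : IsFrac g a b) : charFun K g = cylFun K x.vertex a := by
  rw [charFun, h.XSet_eq, cylFun]

theorem charFun_eq_zero {x y : FreePathGroupoid Γ} {g : x ⟶ y}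
    (h : ¬ ∃ a b, IsFrac g a b) : charFun K g = 0 := by
  rw [charFun, XSet_eq_empty h, Set.indicator_empty]
  rfl

theorem isFrac_frac_nil {x : FreePathGroupoid Γ} {z : Γ.V} {c : List Γ.E}
    (hc : Γ.IsPath x.vertex c z) : IsFrac (frac (y := of z) (b := []) hc rfl) c [] :=
  isFrac_of_isReduced (isReduced_pos_append_neg (by simp)) (toGroup_frac _ _)

theorem cylFun_mem_DX (x : Γ.V) (c : List Γ.E) : cylFun K x c ∈ DX Γ K := by
  by_cases h : ∃ z, Γ.IsPath x c z
  · obtain ⟨z, hz⟩ := h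
    have := (isFrac_frac_nil (x := of x) hz).charFun_eq (K := K)
    exact this ▸ (charElt K _).2
  · have : cylFun K x c = 0 := by
      ext ξ
      exact cylFun_eq_zero fun h1 h2 => h (exists_isPath_of_mem_cylSet ⟨h1, h2⟩)
    rw [this]
    exact zero_mem _

variable (K) in
/-- The characteristic function of `cylSet x c`, as an element of `D(X)`. -/
noncomputable def cylElt (x : Γ.V) (c : List Γ.E) : DX Γ K := ⟨cylFun K x c, cylFun_mem_DX x c⟩

theorem mem_DIdeal_iff {x y : FreePathGroupoid Γ} {g : x ⟶ y} {f : DX Γ K} :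
    f ∈ DIdeal K g ↔ ∀ ξ ∉ XSet g, (f : BoundaryPath Γ → K) ξ = 0 := by
  constructor
  · rintro ⟨k, rfl⟩ ξ hξ
    change charFun K g ξ * _ = 0
    rw [charFun, Set.indicator_of_notMem hξ, zero_mul]
  · intro h
    refine ⟨f, Subtype.ext (funext fun ξ => ?_)⟩
    change _ = charFun K g ξ * (f : BoundaryPath Γ → K) ξ
    by_cases hξ : ξ ∈ XSet g
    · rw [charFun, Set.indicator_of_mem hξ, Pi.one_apply, one_mul]
    · rw [h ξ hξ, mul_zero]

theorem cylFun_mul_cylFun_mem_span (x x' : Γ.V) (a c : List Γ.E) :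
    cylFun K x a * cylFun K x' c ∈
      Submodule.span K (Set.range fun t => cylFun K x (a ++ t)) := by
  have hmul : cylFun K x a * cylFun K x' c = (cylSet x a ∩ cylSet x' c).indicator 1 := by
    rw [Set.inter_indicator_one]; rfl
  rw [hmul]
  rcases (cylSet x a ∩ cylSet x' c).eq_empty_or_nonempty with he | ⟨ξ, h1, h2⟩
  · rw [he, Set.indicator_empty]
    exact Submodule.zero_mem _
  · obtain rfl : x = x' := h1.1.symm.trans h2.1
    rcases h1.2.comparable h2.2 with ⟨t, rfl⟩ | hca
    · refine Submodule.subset_span ⟨t, ?_⟩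
      have : cylSet x (a ++ t) ⊆ cylSet x a :=
        fun ζ hζ => ⟨hζ.1, hζ.2.mono (List.prefix_append _ _)⟩
      rw [Set.inter_eq_right.2 this]
      rfl
    · refine Submodule.subset_span ⟨[], ?_⟩
      have : cylSet x a ⊆ cylSet x c := fun ζ hζ => ⟨hζ.1, hζ.2.mono hca⟩
      simp only [Set.inter_eq_left.2 this, List.append_nil]
      rfl

/-- If `g = a b⁻¹` in reduced form, then `D_g` is spanned by the cylinder functions of the paths
with initial segment `a`. -/
theorem mem_span_of_mem_DIdeal {x y : FreePathGroupoid Γ} {g : x ⟶ y} {a b : List Γ.E}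
    (hg : IsFrac g a b) {f : DX Γ K} (hf : f ∈ DIdeal K g) :
    (f : BoundaryPath Γ → K) ∈
      Submodule.span K (Set.range fun t => cylFun K x.vertex (a ++ t)) := by
  obtain ⟨⟨k, hk⟩, rfl⟩ := hf
  have hk' : k ∈ Submodule.span K (charFuns Γ K) := hk
  change charFun K g * k ∈ _
  clear hk
  induction hk' using Submodule.span_induction with
  | mem k hk =>
    obtain ⟨x', y', h, rfl⟩ := hk
    by_cases hh : ∃ c d, IsFrac h c d
    · obtain ⟨c, d, hh⟩ := hh
      rw [hg.charFun_eq, hh.charFun_eq]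
      exact cylFun_mul_cylFun_mem_span _ _ _ _
    · rw [charFun_eq_zero hh, mul_zero]
      exact Submodule.zero_mem _
  | zero => rw [mul_zero]; exact Submodule.zero_mem _
  | add k k' _ _ h h' => rw [mul_add]; exact Submodule.add_mem _ h h'
  | smul c k _ h => rw [mul_smul_comm]; exact Submodule.smul_mem _ _ h

theorem eq_zero_of_mem_DIdeal {x y : FreePathGroupoid Γ} {g : x ⟶ y}
    (hg : ¬ ∃ a b, IsFrac g a b) {f : DX Γ K} (hf : f ∈ DIdeal K g) : f = 0 := by
  refine Subtype.ext (funext fun ξ => mem_DIdeal_iff.1 hf ξ ?_)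
  rw [XSet_eq_empty hg]
  exact Set.notMem_empty ξ

/-! ### The partial action on `D(X)` -/

/-- For `g = a b⁻¹` in reduced form, `α_g` maps `1_{bt}` to `1_{at}`. -/
theorem alpha_cylFun {x y : FreePathGroupoid Γ} {g : x ⟶ y} {a b : List Γ.E}
    (hg : IsFrac g a b) (t : List Γ.E) :
    alpha K g (cylFun K y.vertex (b ++ t)) = cylFun K x.vertex (a ++ t) := by
  ext ξ
  by_cases hξ : ξ ∈ XSet g
  · obtain ⟨η, hη⟩ := mem_XSet_iff.1 hξ
    rw [alpha_apply_of_act K hη]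
    obtain ⟨a', b', ζ, hg', h1, h2, h3, h4⟩ := hη.exists_isFrac
    obtain rfl := hg.num_eq.symm.trans hg'.num_eq
    obtain rfl := hg.den_eq.symm.trans hg'.den_eq
    refine cylFun_congr ?_
    rw [cylSet, cylSet, Set.mem_ofPred_eq, Set.mem_ofPred_eq, h3, h4, hasInit_append_iff h1,
      hasInit_append_iff h2]
    simp
  · rw [alpha_apply_of_notMem K hξ, cylFun_eq_zero]
    intro h1 h2
    rw [hg.XSet_eq] at hξ
    exact hξ ⟨h1, h2.mono (List.prefix_append _ _)⟩

variable (K) in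
/-- `f ↦ α_g(f)`, as an algebra homomorphism on all functions, not only those in `D_{g⁻¹}`. -/
noncomputable def alphaHom {x y : FreePathGroupoid Γ} (g : x ⟶ y) :
    (BoundaryPath Γ → K) →ₙₐ[K] (BoundaryPath Γ → K) where
  toFun := alpha K g
  map_smul' c f := by
    ext ξ
    by_cases hξ : ξ ∈ XSet g <;> simp [alpha, hξ]
  map_zero' := by
    ext ξ
    by_cases hξ : ξ ∈ XSet g <;> simp [alpha, hξ]
  map_add' f f' := by
    ext ξ
    by_cases hξ : ξ ∈ XSet g <;> simp [alpha, hξ]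
  map_mul' f f' := by
    ext ξ
    by_cases hξ : ξ ∈ XSet g <;> simp [alpha, hξ]

theorem alpha_mem_DX {x y : FreePathGroupoid Γ} (g : x ⟶ y) {f : DX Γ K}
    (hf : f ∈ DIdeal K (Groupoid.inv g)) : alpha K g f ∈ DX Γ K := by
  by_cases hg : ∃ a b, IsFrac g a b
  · obtain ⟨a, b, hg⟩ := hg
    have h := mem_span_of_mem_DIdeal hg.inv hf
    change alphaHom K g f ∈ DX Γ K
    generalize (f : BoundaryPath Γ → K) = f at h
    induction h using Submodule.span_induction with
    | mem f h =>
      obtain ⟨t, rfl⟩ := h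
      change alpha K g _ ∈ DX Γ K
      rw [alpha_cylFun hg]
      exact cylFun_mem_DX _ _
    | zero => rw [map_zero]; exact zero_mem _
    | add f f' _ _ h h' => rw [map_add]; exact add_mem h h'
    | smul c f _ h => rw [map_smul]; exact SMulMemClass.smul_mem c h
  · have : alpha K g f = 0 := by
      ext ξ
      refine alpha_apply_of_notMem K ?_ _
      rw [XSet_eq_empty hg]
      exact Set.notMem_empty ξ
    rw [this]
    exact zero_mem _

variable (K) in
/-- The isomorphism `α_g : D_{g⁻¹} → D_g`. -/
noncomputable def alphaIso {x y : FreePathGroupoid Γ} (g : x ⟶ y) :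
    DIdeal K (Groupoid.inv g) →ₙₐ[K] DIdeal K g where
  toFun f := ⟨⟨alpha K g (f : DX Γ K), alpha_mem_DX g f.2⟩,
    mem_DIdeal_iff.2 fun _ hξ => alpha_apply_of_notMem K hξ _⟩
  map_smul' c f := Subtype.ext (Subtype.ext (map_smul (alphaHom K g) c (f : BoundaryPath Γ → K)))
  map_zero' := Subtype.ext (Subtype.ext (map_zero (alphaHom K g)))
  map_add' f f' := Subtype.ext (Subtype.ext
    (map_add (alphaHom K g) (f : BoundaryPath Γ → K) (f' : BoundaryPath Γ → K)))
  map_mul' f f' := Subtype.ext (Subtype.ext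
    (map_mul (alphaHom K g) (f : BoundaryPath Γ → K) (f' : BoundaryPath Γ → K)))

theorem alpha_alpha_inv {x y : FreePathGroupoid Γ} (g : x ⟶ y) {f : DX Γ K}
    (hf : f ∈ DIdeal K g) : alpha K g (alpha K (Groupoid.inv g) f) = f := by
  ext ξ
  by_cases hξ : ξ ∈ XSet g
  · obtain ⟨η, hη⟩ := mem_XSet_iff.1 hξ
    rw [alpha_apply_of_act K hη, alpha_apply_of_act K hη.inv]
  · rw [alpha_apply_of_notMem K hξ, mem_DIdeal_iff.1 hf ξ hξ]

variable (K Γ) in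
/-- The partial action of the free path groupoid on `D(X)`. -/
noncomputable def pathAction : PartialAction K (FreePathGroupoid Γ) (DX Γ K) where
  D g := DIdeal K g
  ideal_id x k a ha := by
    rw [mem_DIdeal_iff] at ha
    constructor <;> rw [mem_DIdeal_iff] <;> intro ξ hξ <;> have h0 := ha ξ hξ
    · exact (congrArg _ h0).trans (mul_zero _)
    · exact (congrArg (· * _) h0).trans (zero_mul _)
  le_id g a ha := by
    rw [mem_DIdeal_iff] at ha ⊢
    intro ξ hξ
    refine ha ξ fun h => hξ (mem_XSet_iff.2 ⟨ξ, act_id_iff.2 ⟨rfl, ?_⟩⟩)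
    obtain ⟨η, hη⟩ := mem_XSet_iff.1 h
    exact hη.source_left
  ideal g k hk a ha := by
    rw [mem_DIdeal_iff] at ha
    constructor <;> rw [mem_DIdeal_iff] <;> intro ξ hξ <;> have h0 := ha ξ hξ
    · exact (congrArg _ h0).trans (mul_zero _)
    · exact (congrArg (· * _) h0).trans (zero_mul _)
  act g := alphaIso K g
  bijective {x y} g := by
    constructor
    · intro f f' h
      have h' : alpha K g (f : DX Γ K) = alpha K g (f' : DX Γ K) :=
        congrArg (fun t : DIdeal K g => ((t : DX Γ K) : BoundaryPath Γ → K)) h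
      have h1 := alpha_alpha_inv (Groupoid.inv g) f.2
      have h2 := alpha_alpha_inv (Groupoid.inv g) f'.2
      rw [inv_inv'] at h1 h2
      exact Subtype.ext (Subtype.ext (h1.symm.trans ((congrArg _ h').trans h2)))
    · intro f
      refine ⟨alphaIso K (Groupoid.inv g) ⟨f, (inv_inv' g).symm ▸ f.2⟩, ?_⟩
      exact Subtype.ext (Subtype.ext (alpha_alpha_inv g f.2))
  act_id x f := by
    refine Subtype.ext (funext fun ξ => ?_)
    change alpha K (𝟙 x) (f : DX Γ K) ξ = _
    by_cases hξ : ξ ∈ XSet (𝟙 x)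
    · obtain ⟨η, hη⟩ := mem_XSet_iff.1 hξ
      rw [alpha_apply_of_act K hη, (act_id_iff.1 hη).1]
    · rw [alpha_apply_of_notMem K hξ]
      refine (mem_DIdeal_iff.1 f.2 ξ fun h => hξ ?_).symm
      obtain ⟨η, hη⟩ := mem_XSet_iff.1 h
      obtain ⟨rfl, h'⟩ := act_id_iff.1 (act_inv_iff.1 hη)
      exact mem_XSet_iff.2 ⟨_, act_id_iff.2 ⟨rfl, h'⟩⟩
  mem_comp g h f hf := by
    rw [mem_DIdeal_iff] at hf ⊢
    intro ξ hξ
    by_contra hne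
    have h1 : ξ ∈ XSet (Groupoid.inv h) := by
      by_contra h1
      exact hne (mem_DIdeal_iff.1 f.2 ξ h1)
    obtain ⟨η, hη⟩ := mem_XSet_iff.1 h1
    rw [act_inv_iff] at hη
    have h2 : alpha K h (f : DX Γ K) η = (f : DX Γ K).1 ξ := alpha_apply_of_act K hη _
    have h3 : η ∈ XSet (Groupoid.inv g) := by
      by_contra h3
      exact hne (h2.symm.trans (hf η h3))
    obtain ⟨ζ, hζ⟩ := mem_XSet_iff.1 h3
    exact hξ ((act_inv_iff.1 hζ).comp hη).mem_XSet_inv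
  act_comp g h f hf := by
    refine Subtype.ext (funext fun ξ => ?_)
    change alpha K g (alpha K h (f : DX Γ K)) ξ = alpha K (g ≫ h) (f : DX Γ K) ξ
    by_cases h1 : ∃ η ζ, Act g ξ η ∧ Act h η ζ
    · obtain ⟨η, ζ, h1, h2⟩ := h1
      rw [alpha_apply_of_act K h1, alpha_apply_of_act K h2, alpha_apply_of_act K (h1.comp h2)]
    have hl : alpha K g (alpha K h (f : DX Γ K)) ξ = 0 := by
      by_cases hξ : ξ ∈ XSet g
      · obtain ⟨η, hη⟩ := mem_XSet_iff.1 hξ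
        rw [alpha_apply_of_act K hη]
        refine alpha_apply_of_notMem K (fun hη' => h1 ?_) _
        obtain ⟨ζ, hζ⟩ := mem_XSet_iff.1 hη'
        exact ⟨η, ζ, hη, hζ⟩
      · exact alpha_apply_of_notMem K hξ _
    rw [hl]
    by_cases hξ : ξ ∈ XSet (g ≫ h)
    · obtain ⟨ζ, hζ⟩ := mem_XSet_iff.1 hξ
      rw [alpha_apply_of_act K hζ]
      by_contra hne
      -- If `f` does not vanish at `ζ`, then `θ_h` and `θ_g θ_h` are defined at `ζ`.
      have h2 : ζ ∈ XSet (Groupoid.inv h) := by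
        by_contra h2
        exact hne (mem_DIdeal_iff.1 f.2 ζ h2).symm
      obtain ⟨η, hη⟩ := mem_XSet_iff.1 h2
      rw [act_inv_iff] at hη
      have h3 : η ∈ XSet (Groupoid.inv g) := by
        by_contra h3
        refine hne ((mem_DIdeal_iff.1 hf η h3).symm.trans ?_)
        exact alpha_apply_of_act K hη _
      obtain ⟨ξ', hξ'⟩ := mem_XSet_iff.1 h3
      rw [act_inv_iff] at hξ'
      obtain rfl := (hξ'.comp hη).left_unique hζ
      exact h1 ⟨η, ζ, hξ', hη⟩
    · exact (alpha_apply_of_notMem K hξ _).symm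

end Cylinder

/-! ### The partial skew groupoid ring of the path action -/

namespace PartialAction

variable {K : Type*} [CommRing K] {C : Type*} [Groupoid C]
  {R : Type*} [NonUnitalRing R] [Module K R] {A : PartialAction K C R}

theorem skewRing_induction {p : A.SkewRing → Prop} (a : A.SkewRing) (zero : p 0)
    (delta : ∀ {x y : C} (g : x ⟶ y) (a : A.D g), p (A.delta g a))
    (add : ∀ a b, p a → p b → p (a + b)) : p a :=
  DirectSum.induction_on a zero (fun ⟨_, _, g⟩ a => delta g a) add

theorem delta_congr {x y : C} {g h : x ⟶ y} (hgh : g = h) {a : A.D g} {b : A.D h}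
    (hab : (a : R) = b) : A.delta g a = A.delta h b := by
  subst hgh
  rw [Subtype.ext hab]

variable [IsScalarTower K R R] [SMulCommClass K R R]

instance : IsScalarTower K A.SkewRing A.SkewRing where
  smul_assoc c a b := by
    change A.mulHom (c • a) b = c • A.mulHom a b
    rw [map_smul, LinearMap.smul_apply]

instance : SMulCommClass K A.SkewRing A.SkewRing where
  smul_comm c a b := (map_smul (A.mulHom a) c b).symm

end PartialAction

section PathAction

variable {Γ : DirectedGraph.{u, v}} {K : Type w} [Field K]
  {x y z t : FreePathGroupoid Γ} {g : x ⟶ y} {h : y ⟶ z} {ξ η ζ : BoundaryPath Γ}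

theorem twist_apply_of_act (a : (pathAction Γ K).D g) (b : (pathAction Γ K).D h)
    (H : Act g ξ η) :
    (((pathAction Γ K).twist g h a b : DX Γ K) : BoundaryPath Γ → K) ξ =
      (a : DX Γ K).1 ξ * (b : DX Γ K).1 η := by
  change alpha K g (alpha K (Groupoid.inv g) (a : DX Γ K) * (b : DX Γ K).1) ξ = _
  rw [alpha_apply_of_act K H, Pi.mul_apply, alpha_apply_of_act K H.inv]

theorem twist_apply_of_notMem (a : (pathAction Γ K).D g) (b : (pathAction Γ K).D h)
    (H : ξ ∉ XSet g) :
    (((pathAction Γ K).twist g h a b : DX Γ K) : BoundaryPath Γ → K) ξ = 0 :=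
  alpha_apply_of_notMem K H _

/-- A product `a δ_g · b δ_h` is determined by `(a δ_g · b δ_h)(ξ) = a(ξ) b(θ_{g⁻¹}(ξ))` on
`X_g`. -/
theorem delta_mul_delta_eq {k : x ⟶ z} (hk : k = g ≫ h) {a : (pathAction Γ K).D g}
    {b : (pathAction Γ K).D h} {c : (pathAction Γ K).D k}
    (H : ∀ ξ η, Act g ξ η → (c : DX Γ K).1 ξ = (a : DX Γ K).1 ξ * (b : DX Γ K).1 η)
    (H' : ∀ ξ ∉ XSet g, (c : DX Γ K).1 ξ = 0) :
    (pathAction Γ K).delta g a * (pathAction Γ K).delta h b = (pathAction Γ K).delta k c := by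
  rw [PartialAction.delta_mul_delta]
  refine PartialAction.delta_congr hk.symm (Subtype.ext (funext fun ξ => ?_))
  by_cases hξ : ξ ∈ XSet g
  · obtain ⟨η, hη⟩ := mem_XSet_iff.1 hξ
    exact (twist_apply_of_act a b hη).trans (H ξ η hη).symm
  · exact (twist_apply_of_notMem a b hξ).trans (H' ξ hξ).symm

theorem delta_mul_assoc {k : z ⟶ t} (a : (pathAction Γ K).D g) (b : (pathAction Γ K).D h)
    (c : (pathAction Γ K).D k) :
    (pathAction Γ K).delta g a * (pathAction Γ K).delta h b * (pathAction Γ K).delta k c =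
      (pathAction Γ K).delta g a *
        ((pathAction Γ K).delta h b * (pathAction Γ K).delta k c) := by
  rw [PartialAction.delta_mul_delta, PartialAction.delta_mul_delta _ h k,
    PartialAction.delta_mul_delta _ g (h ≫ k)]
  refine delta_mul_delta_eq (Category.assoc g h k).symm ?_ ?_
  · intro ξ ζ hζ
    by_cases hξ : ξ ∈ XSet g
    · obtain ⟨η, hη⟩ := mem_XSet_iff.1 hξ
      rw [twist_apply_of_act a b hη, twist_apply_of_act a _ hη, mul_assoc]
      by_cases hη' : η ∈ XSet h
      · obtain ⟨ζ', hζ'⟩ := mem_XSet_iff.1 hη'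
        obtain rfl := (hη.comp hζ').right_unique hζ
        rw [twist_apply_of_act b c hζ']
      · rw [twist_apply_of_notMem b c hη', mem_DIdeal_iff.1 b.2 η hη', zero_mul]
    · rw [twist_apply_of_notMem a _ hξ, twist_apply_of_notMem a b hξ, zero_mul]
  · intro ξ hξ
    by_cases hξ' : ξ ∈ XSet g
    · obtain ⟨η, hη⟩ := mem_XSet_iff.1 hξ'
      rw [twist_apply_of_act a _ hη, twist_apply_of_notMem b c, mul_zero]
      intro hη'
      obtain ⟨ζ, hζ⟩ := mem_XSet_iff.1 hη'
      exact hξ (hη.comp hζ).mem_XSet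
    · exact twist_apply_of_notMem a _ hξ'

theorem skewRing_mul_assoc (a b c : (pathAction Γ K).SkewRing) : a * b * c = a * (b * c) := by
  induction a using PartialAction.skewRing_induction with
  | zero => rw [zero_mul, zero_mul, zero_mul]
  | add a a' h h' => rw [add_mul, add_mul, add_mul, h, h']
  | delta g a =>
    induction b using PartialAction.skewRing_induction with
    | zero => rw [zero_mul, mul_zero, zero_mul]
    | add b b' h h' => rw [add_mul, mul_add, mul_add, add_mul, h, h']
    | @delta y' z h b =>
      induction c using PartialAction.skewRing_induction with
      | zero => rw [mul_zero, mul_zero, mul_zero]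
      | add c c' h h' => rw [mul_add, mul_add, mul_add, h, h']
      | @delta z' t k c =>
        rename_i y
        by_cases hy : y = y'
        · subst hy
          by_cases hz : z = z'
          · subst hz
            exact delta_mul_assoc a b c
          · rw [PartialAction.delta_mul_delta, PartialAction.delta_mul_delta_of_ne _ hz,
              PartialAction.delta_mul_delta_of_ne _ hz, mul_zero]
        · rw [PartialAction.delta_mul_delta_of_ne _ hy, zero_mul]
          by_cases hz : z = z'
          · subst hz
            rw [PartialAction.delta_mul_delta _ h, PartialAction.delta_mul_delta_of_ne _ hy]
          · rw [PartialAction.delta_mul_delta_of_ne _ hz, mul_zero]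

noncomputable instance : NonUnitalRing (pathAction Γ K).SkewRing where
  mul_assoc := skewRing_mul_assoc

/-! ### The elements `1_a δ_{a b⁻¹}` -/

section Frac

variable {p q : Γ.V} {a b c d s : List Γ.E}

/-- If `ξ = θ_g(η)` for `g = a b⁻¹`, then `ξ` begins with `as` if and only if `η` begins with `bs`. -/
theorem mem_cylSet_iff_of_act_frac {ha : Γ.IsPath x.vertex a p} {hb : Γ.IsPath y.vertex b p}
    (h : Act (frac ha hb) ξ η) :
    ξ ∈ cylSet x.vertex (a ++ s) ↔ η ∈ cylSet y.vertex (b ++ s) := by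
  obtain ⟨a₀, b₀, ζ, hg, h1, h2, h3, h4⟩ := h.exists_isFrac
  obtain ⟨a₁, b₁, r, hg', rfl, rfl⟩ := exists_isFrac_of_toGroup_eq (toGroup_frac ha hb)
  obtain rfl := hg.num_eq.symm.trans hg'.num_eq
  obtain rfl := hg.den_eq.symm.trans hg'.den_eq
  rw [cylSet, cylSet, Set.mem_ofPred_eq, Set.mem_ofPred_eq, h3, h4, List.append_assoc,
    List.append_assoc, hasInit_append_iff h1, hasInit_append_iff h2]
  simp

theorem cylSet_subset_XSet_frac (ha : Γ.IsPath x.vertex a p) (hb : Γ.IsPath y.vertex b p) :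
    cylSet x.vertex a ⊆ XSet (frac ha hb) := by
  rintro ξ ⟨hs, hi⟩
  obtain ⟨ζ, hζ⟩ := hi.exists_concat
  have h := hζ.isPath
  rw [hs] at h
  obtain rfl := pathOf_end_unique h ha
  obtain ⟨η, hη, hη'⟩ := exists_concat hb
  exact mem_XSet_iff.2 ⟨η, a, b, ζ, toGroup_frac ha hb, hζ, hη, hs, hη'⟩

theorem cylSet_append_subset (x : Γ.V) (a s : List Γ.E) : cylSet x (a ++ s) ⊆ cylSet x a :=
  fun _ h => ⟨h.1, h.2.mono (List.prefix_append _ _)⟩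

theorem cylElt_mem_DIdeal_frac (ha : Γ.IsPath x.vertex a p) (hb : Γ.IsPath y.vertex b p) :
    cylElt K x.vertex a ∈ DIdeal K (frac ha hb) :=
  mem_DIdeal_iff.2 fun _ hξ =>
    cylFun_eq_zero fun h1 h2 => hξ (cylSet_subset_XSet_frac ha hb ⟨h1, h2⟩)

variable (K) in
/-- The element `1_a δ_g` of the skew ring, where `g = a b⁻¹`; if this is not in reduced form, then
`1_a` is strictly smaller than `1_g`. It corresponds to `a b*` in the Leavitt path algebra. -/
noncomputable def fracDelta (ha : Γ.IsPath x.vertex a p) (hb : Γ.IsPath y.vertex b p) :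
    (pathAction Γ K).SkewRing :=
  (pathAction Γ K).delta (frac ha hb) ⟨cylElt K x.vertex a, cylElt_mem_DIdeal_frac ha hb⟩

theorem fracDelta_mul_fracDelta_left (ha : Γ.IsPath x.vertex a p) (hb : Γ.IsPath y.vertex b p)
    (hc : Γ.IsPath y.vertex (b ++ s) q) (hd : Γ.IsPath z.vertex d q)
    (has : Γ.IsPath x.vertex (a ++ s) q) :
    fracDelta K ha hb * fracDelta K hc hd = fracDelta K has hd := by
  refine delta_mul_delta_eq (toGroup_injective ?_) ?_ ?_
  · rw [toGroup_comp, toGroup_frac, toGroup_frac, toGroup_frac, posGroup_append,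
      posGroup_append]
    group
  · intro ξ η h
    change cylFun K _ _ ξ = cylFun K _ _ ξ * cylFun K _ _ η
    have h' := mem_cylSet_iff_of_act_frac (s := s) h
    rw [cylFun_congr h']
    by_cases hη : η ∈ cylSet y.vertex (b ++ s)
    · have hξ := cylSet_append_subset _ _ _ (h'.2 hη)
      rw [cylFun_eq_one hξ.1 hξ.2, one_mul]
    · rw [cylFun_eq_zero fun h1 h2 => hη ⟨h1, h2⟩, mul_zero]
  · intro ξ hξ
    exact cylFun_eq_zero fun h1 h2 =>
      hξ (cylSet_subset_XSet_frac ha hb (cylSet_append_subset _ _ _ ⟨h1, h2⟩))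

theorem fracDelta_mul_fracDelta_right (ha : Γ.IsPath x.vertex a p)
    (hb : Γ.IsPath y.vertex (c ++ s) p) (hc : Γ.IsPath y.vertex c q)
    (hd : Γ.IsPath z.vertex d q) (hds : Γ.IsPath z.vertex (d ++ s) p) :
    fracDelta K ha hb * fracDelta K hc hd = fracDelta K ha hds := by
  refine delta_mul_delta_eq (toGroup_injective ?_) ?_ ?_
  · rw [toGroup_comp, toGroup_frac, toGroup_frac, toGroup_frac, posGroup_append,
      posGroup_append]
    group
  · intro ξ η h
    change cylFun K _ _ ξ = cylFun K _ _ ξ * cylFun K _ _ η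
    have h' := mem_cylSet_iff_of_act_frac (s := []) h
    rw [List.append_nil, List.append_nil] at h'
    by_cases hξ : ξ ∈ cylSet x.vertex a
    · have hη := cylSet_append_subset _ _ _ (h'.1 hξ)
      rw [cylFun_eq_one hη.1 hη.2, mul_one]
    · rw [cylFun_eq_zero fun h1 h2 => hξ ⟨h1, h2⟩, zero_mul]
  · intro ξ hξ
    exact cylFun_eq_zero fun h1 h2 => hξ (cylSet_subset_XSet_frac ha hb ⟨h1, h2⟩)

theorem fracDelta_mul_fracDelta_of_not_prefix (ha : Γ.IsPath x.vertex a p)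
    (hb : Γ.IsPath y.vertex b p) (hc : Γ.IsPath y.vertex c q) (hd : Γ.IsPath z.vertex d q)
    (hbc : ¬ b <+: c) (hcb : ¬ c <+: b) : fracDelta K ha hb * fracDelta K hc hd = 0 := by
  rw [← map_zero ((pathAction Γ K).delta (frac ha hb ≫ frac hc hd))]
  refine delta_mul_delta_eq rfl ?_ fun _ _ => rfl
  intro ξ η h
  change 0 = cylFun K _ _ ξ * cylFun K _ _ η
  have h' := mem_cylSet_iff_of_act_frac (s := []) h
  rw [List.append_nil, List.append_nil] at h'
  by_cases hξ : ξ ∈ cylSet x.vertex a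
  · rw [cylFun_eq_zero (x := y.vertex), mul_zero]
    exact fun _ h2 => ((h'.1 hξ).2.comparable h2).elim hbc hcb
  · rw [cylFun_eq_zero fun h1 h2 => hξ ⟨h1, h2⟩, zero_mul]

theorem fracDelta_mul_fracDelta_of_ne (hyz : y ≠ z) (ha : Γ.IsPath x.vertex a p)
    (hb : Γ.IsPath y.vertex b p) (hc : Γ.IsPath z.vertex c q) (hd : Γ.IsPath t.vertex d q) :
    fracDelta K ha hb * fracDelta K hc hd = 0 :=
  PartialAction.delta_mul_delta_of_ne _ hyz _ _ _ _

end Frac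

end PathAction

/-! ### The Leavitt path algebra -/

namespace LeavittPathAlgebra

variable {Γ : DirectedGraph.{u, v}} {K : Type w} [Field K]

theorem mk_add (a b : LeavittFree Γ K) : mk (a + b) = mk a + mk b := rfl

theorem mk_smul (c : K) (a : LeavittFree Γ K) : mk (c • a) = c • mk a := rfl

theorem mk_sum {ι : Type*} (s : Finset ι) (f : ι → LeavittFree Γ K) :
    mk (∑ i ∈ s, f i) = ∑ i ∈ s, mk (f i) :=
  map_sum (⟨⟨mk, rfl⟩, mk_add⟩ : LeavittFree Γ K →+ LeavittPathAlgebra Γ K) f s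

theorem mk_eq_mk {a b : LeavittFree Γ K} (h : LeavittRel Γ K a b) : mk a = mk b :=
  Quotient.sound' (RingConGen.Rel.of a b h)

instance : IsScalarTower K (LeavittPathAlgebra Γ K) (LeavittPathAlgebra Γ K) where
  smul_assoc c a b := by
    obtain ⟨a, rfl⟩ := mk_surjective a
    obtain ⟨b, rfl⟩ := mk_surjective b
    exact congrArg mk (smul_mul_assoc c a b)

instance : SMulCommClass K (LeavittPathAlgebra Γ K) (LeavittPathAlgebra Γ K) where
  smul_comm c a b := by
    obtain ⟨a, rfl⟩ := mk_surjective a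
    obtain ⟨b, rfl⟩ := mk_surjective b
    exact congrArg mk (mul_smul_comm c a b).symm

/-- The universal property of the Leavitt path algebra, for homomorphisms from the free algebra. -/
noncomputable def lift {B : Type*} [NonUnitalNonAssocSemiring B] [Module K B]
    (f : LeavittFree Γ K →ₙₐ[K] B) (hf : ∀ a b, LeavittRel Γ K a b → f a = f b) :
    LeavittPathAlgebra Γ K →ₙₐ[K] B :=
  let c : RingCon (LeavittFree Γ K) :=
    { r := fun a b => f a = f b
      iseqv := ⟨fun _ => rfl, Eq.symm, Eq.trans⟩
      mul' := fun h h' => by rw [map_mul, map_mul, h, h']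
      add' := fun h h' => by rw [map_add, map_add, h, h'] }
  have hc : ringConGen (LeavittRel Γ K) ≤ c := RingCon.ringConGen_le.2 hf
  { toFun := Quotient.lift f fun _ _ h => hc h
    map_smul' := by
      intro k a
      obtain ⟨a, rfl⟩ := mk_surjective a
      exact map_smul f k a
    map_zero' := map_zero f
    map_add' := by
      intro a b
      obtain ⟨a, rfl⟩ := mk_surjective a
      obtain ⟨b, rfl⟩ := mk_surjective b
      exact map_add f a b
    map_mul' := by
      intro a b
      obtain ⟨a, rfl⟩ := mk_surjective a
      obtain ⟨b, rfl⟩ := mk_surjective b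
      exact map_mul f a b }

theorem vertex_mul_self (x : Γ.V) : vertex K x * vertex K x = vertex K x :=
  mk_eq_mk (.vertex_mul_self x)

theorem vertex_mul_of_ne {x y : Γ.V} (h : x ≠ y) : vertex K x * vertex K y = 0 :=
  mk_eq_mk (.vertex_mul_of_ne x y h)

theorem source_mul_edge (e : Γ.E) : vertex K (Γ.s e) * edge K e = edge K e :=
  mk_eq_mk (.source_mul_edge e)

theorem edge_mul_range (e : Γ.E) : edge K e * vertex K (Γ.r e) = edge K e :=
  mk_eq_mk (.edge_mul_range e)

theorem range_mul_ghost (e : Γ.E) : vertex K (Γ.r e) * ghost K e = ghost K e :=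
  mk_eq_mk (.range_mul_ghost e)

theorem ghost_mul_source (e : Γ.E) : ghost K e * vertex K (Γ.s e) = ghost K e :=
  mk_eq_mk (.ghost_mul_source e)

theorem ghost_mul_edge_self (e : Γ.E) : ghost K e * edge K e = vertex K (Γ.r e) :=
  mk_eq_mk (.ghost_mul_self e)

theorem ghost_mul_edge_of_ne {e f : Γ.E} (h : e ≠ f) : ghost K e * edge K f = 0 :=
  mk_eq_mk (.ghost_mul_of_ne e f h)

theorem vertex_eq_sum (x : Γ.V) (hfin : {e : Γ.E | Γ.s e = x}.Finite)
    (h : {e : Γ.E | Γ.s e = x}.Nonempty) :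
    vertex K x = ∑ e ∈ hfin.toFinset, edge K e * ghost K e := by
  refine (mk_eq_mk (.cuntzKrieger x hfin h)).trans ?_
  rw [mk_sum]
  rfl

variable (K)

/-- The element `a` of the Leavitt path algebra, for a path `a` starting at the vertex `x`. -/
noncomputable def path : Γ.V → List Γ.E → LeavittPathAlgebra Γ K
  | x, [] => vertex K x
  | _, e :: a => edge K e * path (Γ.r e) a

/-- The element `b*` of the Leavitt path algebra, for a path `b` starting at the vertex `x`. -/
noncomputable def ghostPath : Γ.V → List Γ.E → LeavittPathAlgebra Γ K
  | x, [] => vertex K x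
  | _, e :: b => ghostPath (Γ.r e) b * ghost K e

variable {K} {x y z : Γ.V} {a b c : List Γ.E}

theorem vertex_mul_path (h : Γ.IsPath x a z) : vertex K x * path K x a = path K x a := by
  cases a with
  | nil => exact vertex_mul_self x
  | cons e a =>
    obtain ⟨rfl, -⟩ := h
    rw [path, ← mul_assoc, source_mul_edge]

theorem ghostPath_mul_vertex (h : Γ.IsPath x b z) :
    ghostPath K x b * vertex K x = ghostPath K x b := by
  cases b with
  | nil => exact vertex_mul_self x
  | cons e b =>
    obtain ⟨rfl, -⟩ := h
    rw [ghostPath, mul_assoc, ghost_mul_source]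

theorem ghostPath_append (h : Γ.IsPath x a z) (hb : Γ.IsPath z b y) :
    ghostPath K x (a ++ b) = ghostPath K z b * ghostPath K x a := by
  induction a generalizing x with
  | nil =>
    obtain rfl := (h : x = z)
    exact (ghostPath_mul_vertex hb).symm
  | cons e a ih => rw [List.cons_append, ghostPath, ghostPath, ih h.2, mul_assoc]

theorem isPath_nil (z : Γ.V) : Γ.IsPath z [] z := rfl

theorem vertex_mul_ghostPath (h : Γ.IsPath x b z) :
    vertex K z * ghostPath K x b = ghostPath K x b := by
  have := ghostPath_append (K := K) h (isPath_nil z)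
  rw [List.append_nil] at this
  exact this.symm

theorem ghostPath_mul_path (h : Γ.IsPath x a z) :
    ghostPath K x a * path K x a = vertex K z := by
  induction a generalizing x with
  | nil =>
    obtain rfl := (h : x = z)
    exact vertex_mul_self x
  | cons e a ih =>
    rw [ghostPath, path, mul_assoc, ← mul_assoc (ghost K e), ghost_mul_edge_self,
      vertex_mul_path h.2, ih h.2]

/-- The Leavitt path algebra is spanned by the elements `a b*`, where `a` and `b` are paths with the
same range. -/
theorem mem_span_path_mul_ghostPath (t : LeavittPathAlgebra Γ K) :
    t ∈ Submodule.span K {t : LeavittPathAlgebra Γ K | ∃ x y z a b, Γ.IsPath x a z ∧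
      Γ.IsPath y b z ∧ t = path K x a * ghostPath K y b} := by
  -- It suffices that the span `S` contains the generators and is stable under left multiplication
  -- by them.
  set S := Submodule.span K {t : LeavittPathAlgebra Γ K | ∃ x y z a b, Γ.IsPath x a z ∧
      Γ.IsPath y b z ∧ t = path K x a * ghostPath K y b}
  have hmem : ∀ {x y z a b}, Γ.IsPath x a z → Γ.IsPath y b z →
      path K x a * ghostPath K y b ∈ S :=
    fun ha hb => Submodule.subset_span ⟨_, _, _, _, _, ha, hb, rfl⟩
  have hext : ∀ s : LeavittPathAlgebra Γ K, (∀ {x y z a b}, Γ.IsPath x a z → Γ.IsPath y b z →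
      s * (path K x a * ghostPath K y b) ∈ S) → ∀ t ∈ S, s * t ∈ S := by
    intro s hs t ht
    induction ht using Submodule.span_induction with
    | mem t h =>
      obtain ⟨x, y, z, a, b, ha, hb, rfl⟩ := h
      exact hs ha hb
    | zero => rw [mul_zero]; exact zero_mem _
    | add t t' _ _ h h' => rw [mul_add]; exact add_mem h h'
    | smul c t _ h => rw [mul_smul_comm]; exact S.smul_mem c h
  have hvertex : ∀ v : Γ.V, ∀ t ∈ S, vertex K v * t ∈ S := by
    refine fun v => hext _ fun {x y z a b} ha hb => ?_
    rw [← vertex_mul_path ha, ← mul_assoc, ← mul_assoc]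
    by_cases hv : v = x
    · rw [hv, vertex_mul_self, vertex_mul_path ha]
      exact hmem ha hb
    · rw [vertex_mul_of_ne hv, zero_mul, zero_mul]
      exact zero_mem _
  have hedge : ∀ e : Γ.E, ∀ t ∈ S, edge K e * t ∈ S := by
    refine fun e => hext _ fun {x y z a b} ha hb => ?_
    by_cases hv : Γ.r e = x
    · subst hv
      have := hmem (x := Γ.s e) (a := e :: a) ⟨rfl, ha⟩ hb
      rwa [path, mul_assoc] at this
    · rw [← vertex_mul_path ha, ← edge_mul_range, mul_assoc, ← mul_assoc (vertex K (Γ.r e)),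
        ← mul_assoc (vertex K (Γ.r e)), vertex_mul_of_ne hv, zero_mul, zero_mul, mul_zero]
      exact zero_mem _
  have hghost : ∀ e : Γ.E, ∀ t ∈ S, ghost K e * t ∈ S := by
    refine fun e => hext _ fun {x y z a b} ha hb => ?_
    cases a with
    | nil =>
      obtain rfl := (ha : x = z)
      by_cases hv : Γ.s e = x
      · have he : Γ.IsPath x [e] (Γ.r e) := ⟨hv, rfl⟩
        have := hmem (x := Γ.r e) (a := []) rfl (pathOf_append.2 ⟨x, hb, he⟩)
        rw [ghostPath_append hb he, path, ghostPath, ghostPath, ← mul_assoc, ← mul_assoc,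
          vertex_mul_self, range_mul_ghost] at this
        rwa [path, vertex_mul_ghostPath hb]
      · rw [path, ← ghost_mul_source, mul_assoc, ← mul_assoc (vertex K (Γ.s e)),
          vertex_mul_of_ne hv, zero_mul, mul_zero]
        exact zero_mem _
    | cons f a =>
      obtain ⟨rfl, ha⟩ := ha
      rw [path, mul_assoc, ← mul_assoc (ghost K e)]
      by_cases hef : e = f
      · subst hef
        rw [ghost_mul_edge_self]
        exact hvertex _ _ (hmem ha hb)
      · rw [ghost_mul_edge_of_ne hef, zero_mul]
        exact zero_mem _
  have hgen : ∀ g : LeavittGen Γ, mk (LeavittFree.gen K g) ∈ S ∧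
      ∀ t ∈ S, mk (LeavittFree.gen K g) * t ∈ S := by
    have hv : ∀ v : Γ.V, vertex K v ∈ S := fun v => by
      have := hmem (x := v) (y := v) (a := []) (b := []) rfl rfl
      rwa [path, ghostPath, vertex_mul_self] at this
    rintro (v | e | e)
    · exact ⟨hv v, hvertex v⟩
    · have := hedge e _ (hv (Γ.r e))
      rw [edge_mul_range] at this
      exact ⟨this, hedge e⟩
    · have := hghost e _ (hv (Γ.s e))
      rw [ghost_mul_source] at this
      exact ⟨this, hghost e⟩
  have hword : ∀ l : FreeSemigroup (LeavittGen Γ),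
      (mk (MonoidAlgebra.single l 1 : LeavittFree Γ K) : LeavittPathAlgebra Γ K) ∈ S := by
    intro l
    induction l using FreeSemigroup.recOnMul with
    | ih1 g => exact (hgen g).1
    | ih2 g l _ h =>
      have : (MonoidAlgebra.single (FreeSemigroup.of g * l) 1 : LeavittFree Γ K) =
          LeavittFree.gen K g * MonoidAlgebra.single l 1 := by
        rw [LeavittFree.gen, MonoidAlgebra.single_mul_single, mul_one]
      rw [this]
      exact (hgen g).2 _ h
  obtain ⟨t, rfl⟩ := mk_surjective t
  induction t using MonoidAlgebra.induction_linear with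
  | zero => exact zero_mem _
  | add t t' h h' => exact add_mem h h'
  | single l c =>
    have : (MonoidAlgebra.single l c : LeavittFree Γ K) = c • MonoidAlgebra.single l 1 := by
      simp
    rw [this, mk_smul]
    exact S.smul_mem c (hword l)

end LeavittPathAlgebra

/-! ### Relations between cylinder functions -/

theorem BoundaryPath.exists_source_eq {Γ : DirectedGraph.{u, v}} (x : Γ.V) :
    ∃ ξ : BoundaryPath Γ, ξ.source = x := by
  by_cases h : ∃ l y, Γ.IsPath x l y ∧ Γ.IsSink y
  · obtain ⟨l, y, hl, hy⟩ := h
    exact ⟨.fin x l y hl hy, rfl⟩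
  -- No sink can be reached from `x`, so that a path from `x` can be prolonged indefinitely.
  have hnext : ∀ v : {v : Γ.V // ∃ l, Γ.IsPath x l v}, ∃ e, Γ.s e = v := by
    rintro ⟨v, l, hl⟩
    by_contra hv
    exact h ⟨l, v, hl, fun e he => hv ⟨e, he⟩⟩
  choose e he using hnext
  let next : {v : Γ.V // ∃ l, Γ.IsPath x l v} → {v : Γ.V // ∃ l, Γ.IsPath x l v} :=
    fun v => ⟨Γ.r (e v), by
      obtain ⟨l, hl⟩ := v.2
      exact ⟨l ++ [e v], pathOf_append.2 ⟨v, hl, he v, rfl⟩⟩⟩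
  let v₀ : {v : Γ.V // ∃ l, Γ.IsPath x l v} := ⟨x, [], rfl⟩
  refine ⟨.inf (fun n => e (next^[n] v₀)) fun n => ?_, he v₀⟩
  change Γ.r (e (next^[n] v₀)) = Γ.s (e (next^[n + 1] v₀))
  rw [he, Function.iterate_succ_apply']

namespace LeavittPathAlgebra

variable {Γ : DirectedGraph.{u, v}} (K : Type w) [Field K]

/-- The projection `cc*` of the Leavitt path algebra for a path `c` starting at `x`, and zero if
`c` is not such a path. -/
noncomputable def cylProj : Γ.V → List Γ.E → LeavittPathAlgebra Γ K
  | x, [] => vertex K x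
  | x, e :: c => if Γ.s e = x then edge K e * cylProj (Γ.r e) c * ghost K e else 0

variable {K}

theorem cylProj_eq {x z : Γ.V} {c : List Γ.E} (h : Γ.IsPath x c z) :
    cylProj K x c = path K x c * ghostPath K x c := by
  induction c generalizing x with
  | nil => exact (vertex_mul_self x).symm
  | cons e c ih =>
    rw [cylProj, if_pos h.1, ih h.2, path, ghostPath, mul_assoc, mul_assoc, mul_assoc]

/-- For a combination `k` of lists of edges, the combination of those lists `c` for which `e :: c`
occurs in `k`. -/
noncomputable def tailAt (e : Γ.E) : (List Γ.E →₀ K) →ₗ[K] (List Γ.E →₀ K) :=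
  Finsupp.lcomapDomain (List.cons e) List.cons_injective

theorem tailAt_apply (e : Γ.E) (k : List Γ.E →₀ K) (c : List Γ.E) :
    tailAt e k c = k (e :: c) := rfl

theorem tailAt_single_nil (e : Γ.E) (r : K) : tailAt e (Finsupp.single [] r) = 0 := by
  ext c
  simp [tailAt_apply]

theorem tailAt_single_cons (e f : Γ.E) (c : List Γ.E) (r : K) :
    tailAt e (Finsupp.single (f :: c) r) = if f = e then Finsupp.single c r else 0 := by
  ext d
  by_cases h : f = e
  · subst h
    simp [tailAt_apply, Finsupp.single_apply]
  · simp [tailAt_apply, h]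

/-- The value at `ξ = eη` of a combination of cylinder functions: the constant term, and the value at
`η` of the part going through `e`. -/
theorem linearCombination_cylFun_apply {x : Γ.V} (k : List Γ.E →₀ K) {e : Γ.E}
    {ξ η : BoundaryPath Γ} (hξ : ξ.source = x) (h : Concat [e] η ξ) :
    Finsupp.linearCombination K (cylFun K x) k ξ =
      k [] + Finsupp.linearCombination K (cylFun K (Γ.r e)) (tailAt e k) η := by
  have hη : η.source = Γ.r e := h.isPath.2.symm
  induction k using Finsupp.induction_linear with
  | zero => simp
  | add k k' h h' =>
    simp only [map_add, Pi.add_apply, h, h', Finsupp.add_apply]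
    ring
  | single c r =>
    cases c with
    | nil =>
      rw [tailAt_single_nil, map_zero, Finsupp.linearCombination_single, Pi.smul_apply,
        cylFun_eq_one hξ (hasInit_nil ξ)]
      simp
    | cons f c =>
      rw [tailAt_single_cons, Finsupp.linearCombination_single, Pi.smul_apply,
        Finsupp.single_eq_of_ne (by simp), zero_add]
      by_cases hef : f = e
      · subst hef
        rw [if_pos rfl, Finsupp.linearCombination_single, Pi.smul_apply]
        congr 1
        refine cylFun_congr ?_
        rw [cylSet, cylSet, Set.mem_ofPred_eq, Set.mem_ofPred_eq, hξ, hη,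
          ← hasInit_append_iff h]
        simp
      · rw [if_neg hef, map_zero, cylFun_eq_zero, smul_zero]
        · rfl
        · intro _ h1
          have h2 := (h1.mono (a := [f]) ⟨c, rfl⟩).comparable h.hasInit
          simp [hef, Ne.symm hef] at h2

/-- A combination of projections `cc*`, split according to the first edge of `c`. -/
theorem linearCombination_cylProj (x : Γ.V) (k : List Γ.E →₀ K) (F : Finset Γ.E)
    (hF : ∀ e c, Γ.s e = x → e :: c ∈ k.support → e ∈ F) (hF' : ∀ e ∈ F, Γ.s e = x) :
    Finsupp.linearCombination K (cylProj K x) k = k [] • vertex K x +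
      ∑ e ∈ F, edge K e * Finsupp.linearCombination K (cylProj K (Γ.r e)) (tailAt e k) *
        ghost K e := by
  have hk : k ∈ Finsupp.supported K K {c : List Γ.E | ∀ e c', Γ.s e = x → c = e :: c' → e ∈ F} :=
    fun c hc e c' he hcc => hF e c' he (hcc ▸ hc)
  clear hF
  rw [Finsupp.supported_eq_span_single] at hk
  induction hk using Submodule.span_induction with
  | zero => simp
  | add k k' _ _ h h' =>
    simp only [map_add, h, h', Finsupp.add_apply, add_smul, mul_add, add_mul,
      Finset.sum_add_distrib]
    abel
  | smul r k _ h =>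
    simp only [map_smul, h, Finsupp.smul_apply, smul_add, Finset.smul_sum, mul_smul_comm,
      smul_mul_assoc, smul_assoc]
  | mem k h =>
    obtain ⟨c, hc, rfl⟩ := h
    cases c with
    | nil => simp [tailAt_single_nil, cylProj]
    | cons f c =>
      simp only [Finsupp.linearCombination_single, one_smul, tailAt_single_cons, cylProj]
      rw [Finsupp.single_eq_of_ne (by simp), zero_smul, zero_add]
      by_cases hf : Γ.s f = x
      · rw [if_pos hf, Finset.sum_eq_single_of_mem f (hc f c hf rfl)]
        · simp
        · intro e _ hef
          rw [if_neg hef.symm, map_zero, mul_zero, zero_mul]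
      · rw [if_neg hf, Finset.sum_eq_zero]
        intro e he
        rw [if_neg, map_zero, mul_zero, zero_mul]
        rintro rfl
        exact hf (hF' _ he)

/-- If a vertex does not emit a positive finite number of edges, then some boundary path starting
there has no initial segment among the nonempty lists in the support of `k`: the path of length zero
at a sink, and a path through an edge that does not occur in `k` otherwise. -/
theorem exists_linearCombination_cylFun_apply_eq {x : Γ.V}
    (hx : ¬ ({e : Γ.E | Γ.s e = x}.Finite ∧ {e : Γ.E | Γ.s e = x}.Nonempty))
    (k : List Γ.E →₀ K) :
    ∃ ξ : BoundaryPath Γ, Finsupp.linearCombination K (cylFun K x) k ξ = k [] := by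
  by_cases hne : {e : Γ.E | Γ.s e = x}.Nonempty
  · have hinf : {e : Γ.E | Γ.s e = x}.Infinite := fun h => hx ⟨h, hne⟩
    obtain ⟨e, he, he'⟩ := hinf.exists_notMem_finset
      (k.support.biUnion fun c => c.head?.toFinset)
    obtain ⟨η, hη⟩ := exists_source_eq (Γ.r e)
    obtain ⟨ξ, h1, h2⟩ := exists_concat (a := [e]) (η := η) (x := x) ⟨he, hη.symm⟩
    refine ⟨ξ, ?_⟩
    have : tailAt e k = 0 := by
      ext c
      by_contra hc
      refine he' (Finset.mem_biUnion.2 ⟨e :: c, Finsupp.mem_support_iff.2 hc, by simp⟩)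
    rw [linearCombination_cylFun_apply k h2 h1, this, map_zero]
    simp
  · have hs : Γ.IsSink x := fun e he => hne ⟨e, he⟩
    obtain ⟨ξ, hξ, hξ'⟩ : ∃ ξ : BoundaryPath Γ, ξ.source = x ∧ ∀ e c, ¬ HasInit (e :: c) ξ :=
      ⟨.fin x [] x rfl hs, rfl, fun _ _ h => List.cons_ne_nil _ _ (List.prefix_nil.1 h)⟩
    refine ⟨ξ, ?_⟩
    induction k using Finsupp.induction_linear with
    | zero => simp
    | add k k' h h' => simp only [map_add, Pi.add_apply, h, h', Finsupp.add_apply]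
    | single c r =>
      rw [Finsupp.linearCombination_single, Pi.smul_apply]
      cases c with
      | nil => rw [cylFun_eq_one hξ (hasInit_nil _)]; simp
      | cons e c =>
        rw [cylFun_eq_zero fun _ => hξ' e c, smul_zero, Finsupp.single_eq_of_ne (by simp)]

/-- Every linear relation between cylinder functions `1_c` also holds between the projections `cc*`
of the Leavitt path algebra. The proof is by induction on the length of the paths involved. -/
theorem linearCombination_cylProj_eq_zero (n : ℕ) (x : Γ.V) (k : List Γ.E →₀ K)
    (hn : ∀ c ∈ k.support, c.length ≤ n)
    (hk : Finsupp.linearCombination K (cylFun K x) k = 0) :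
    Finsupp.linearCombination K (cylProj K x) k = 0 := by
  induction n generalizing x k with
  | zero =>
    have hk' : k = Finsupp.single [] (k []) := by
      ext c
      cases c with
      | nil => simp
      | cons e c =>
        rw [Finsupp.single_eq_of_ne (by simp)]
        by_contra hc
        simpa using hn _ (Finsupp.mem_support_iff.2 hc)
    obtain ⟨ξ, hξ⟩ := exists_source_eq x
    have h0 := congrFun hk ξ
    rw [hk', Finsupp.linearCombination_single, Pi.smul_apply,
      cylFun_eq_one hξ (hasInit_nil ξ)] at h0
    have h0' : k [] = 0 := by simpa using h0
    rw [hk', h0', Finsupp.single_zero, map_zero]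
  | succ n ih =>
    -- Restricting the relation to the boundary paths through an edge `e` shortens it; the constant
    -- term `k []` is then added to the constant term at `r(e)`.
    have key : ∀ e, Γ.s e = x → Finsupp.linearCombination K (cylProj K (Γ.r e)) (tailAt e k) =
        -(k [] • vertex K (Γ.r e)) := by
      intro e he
      have := ih (Γ.r e) (tailAt e k + Finsupp.single [] (k [])) ?_ ?_
      · rw [map_add, Finsupp.linearCombination_single, cylProj] at this
        exact eq_neg_of_add_eq_zero_left this
      · intro c hc
        cases c with
        | nil => simp
        | cons f c =>
          rw [Finsupp.mem_support_iff, Finsupp.add_apply, Finsupp.single_eq_of_ne (by simp),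
            add_zero] at hc
          have := hn _ (Finsupp.mem_support_iff.2 hc)
          simpa using this
      · ext η
        rw [map_add, Finsupp.linearCombination_single, Pi.add_apply, Pi.smul_apply]
        by_cases hη : η.source = Γ.r e
        · obtain ⟨ξ, h1, h2⟩ := exists_concat (a := [e]) (η := η) (x := x) ⟨he, hη.symm⟩
          have h3 := congrFun hk ξ
          rw [linearCombination_cylFun_apply k h2 h1] at h3
          rw [cylFun_eq_one hη (hasInit_nil η), smul_eq_mul, mul_one, add_comm]
          exact h3
        · have : ∀ k : List Γ.E →₀ K,
              Finsupp.linearCombination K (cylFun K (Γ.r e)) k η = 0 := by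
            intro k
            rw [Finsupp.linearCombination_apply, Finsupp.sum, Finset.sum_apply]
            refine Finset.sum_eq_zero fun c _ => ?_
            rw [Pi.smul_apply, cylFun_eq_zero (fun h => (hη h).elim), smul_zero]
          rw [this, cylFun_eq_zero (fun h => (hη h).elim)]
          simp
    by_cases hx : {e : Γ.E | Γ.s e = x}.Finite ∧ {e : Γ.E | Γ.s e = x}.Nonempty
    · obtain ⟨hfin, hne⟩ := hx
      rw [linearCombination_cylProj x k hfin.toFinset (by simp +contextual) (by simp),
        vertex_eq_sum x hfin hne, Finset.smul_sum, ← Finset.sum_add_distrib]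
      refine Finset.sum_eq_zero fun e he => ?_
      rw [key e (by simpa using he), mul_neg, mul_smul_comm, edge_mul_range, neg_mul,
        smul_mul_assoc, add_neg_cancel]
    · obtain ⟨ξ, hξ⟩ := exists_linearCombination_cylFun_apply_eq hx k
      have h0 : k [] = 0 := by rw [← hξ, hk]; rfl
      rw [linearCombination_cylProj x k
        ((k.support.biUnion fun c => c.head?.toFinset).filter fun e => Γ.s e = x) ?_ (by simp),
        h0, zero_smul, zero_add]
      · refine Finset.sum_eq_zero fun e he => ?_
        rw [key e (Finset.mem_filter.1 he).2, h0, zero_smul, neg_zero, mul_zero, zero_mul]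
      · intro e c he hc
        exact Finset.mem_filter.2 ⟨Finset.mem_biUnion.2 ⟨_, hc, by simp⟩, he⟩

/-- The assignment `1_c ↦ cc*` on cylinder functions at `x` extends to a linear map on functions. -/
theorem exists_linearMap_cylFun (x : Γ.V) :
    ∃ f : (BoundaryPath Γ → K) →ₗ[K] LeavittPathAlgebra Γ K,
      ∀ c, f (cylFun K x c) = cylProj K x c := by
  obtain ⟨s, hs⟩ := LinearMap.exists_rightInverse_of_surjective
    (Finsupp.linearCombination K (cylFun K x)).rangeRestrict (LinearMap.range_rangeRestrict _)
  obtain ⟨f, hf⟩ := LinearMap.exists_extend (Finsupp.linearCombination K (cylProj K x) ∘ₗ s)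
  refine ⟨f, fun c => ?_⟩
  let t := (Finsupp.linearCombination K (cylFun K x)).rangeRestrict (Finsupp.single c 1)
  have ht : (t : BoundaryPath Γ → K) = cylFun K x c := by simp [t]
  have h1 : f (cylFun K x c) = Finsupp.linearCombination K (cylProj K x) (s t) := by
    rw [← ht]
    exact LinearMap.congr_fun hf t
  have h2 : Finsupp.linearCombination K (cylFun K x) (s t - Finsupp.single c 1) = 0 := by
    rw [map_sub]
    exact sub_eq_zero.2 (congrArg Subtype.val (LinearMap.congr_fun hs t))
  have h3 := linearCombination_cylProj_eq_zero _ x _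
    (fun c hc => Finset.le_sup (f := List.length) hc) h2
  rw [map_sub, sub_eq_zero, Finsupp.linearCombination_single, one_smul] at h3
  rw [h1, h3]

end LeavittPathAlgebra

/-! ### The isomorphism -/

namespace LeavittPathAlgebra

variable (Γ : DirectedGraph.{u, v}) (K : Type w) [Field K]

theorem isPath_singleton {Γ : DirectedGraph.{u, v}} (e : Γ.E) :
    Γ.IsPath (Γ.s e) [e] (Γ.r e) := ⟨rfl, rfl⟩

/-- The images of the generators of the Leavitt path algebra in the skew ring. -/
noncomputable def genToSkewRing : LeavittGen Γ → (pathAction Γ K).SkewRing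
  | .vertex x => fracDelta K (x := of x) (y := of x) (isPath_nil x) (isPath_nil x)
  | .edge e => fracDelta K (x := of (Γ.s e)) (y := of (Γ.r e)) (isPath_singleton e)
      (isPath_nil (Γ.r e))
  | .ghost e => fracDelta K (x := of (Γ.r e)) (y := of (Γ.s e)) (isPath_nil (Γ.r e))
      (isPath_singleton e)

/-- The extension of `genToSkewRing` to the free algebra. -/
noncomputable def freeToSkewRing : LeavittFree Γ K →ₙₐ[K] (pathAction Γ K).SkewRing :=
  MonoidAlgebra.liftMagma K (FreeSemigroup.lift (genToSkewRing Γ K))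

variable {Γ K}

theorem freeToSkewRing_gen (t : LeavittGen Γ) :
    freeToSkewRing Γ K (LeavittFree.gen K t) = genToSkewRing Γ K t := by
  simp [freeToSkewRing, LeavittFree.gen]

/-- `e e*` corresponds to `1_e δ_x`, where `x` is the source of `e`. -/
theorem genToSkewRing_edge_mul_ghost {x : Γ.V} {e : Γ.E} (he : Γ.s e = x) :
    genToSkewRing Γ K (.edge e) * genToSkewRing Γ K (.ghost e) =
      (pathAction Γ K).delta (frac (x := of x) (y := of x) (isPath_nil x) (isPath_nil x))
        ⟨cylElt K x [e], mem_DIdeal_iff.2 fun _ hξ => cylFun_eq_zero fun h1 _ =>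
          hξ (cylSet_subset_XSet_frac _ _ ⟨h1, hasInit_nil _⟩)⟩ := by
  subst he
  refine (fracDelta_mul_fracDelta_left (s := []) _ _ _ _ (isPath_singleton e)).trans ?_
  refine PartialAction.delta_congr ?_ rfl
  refine toGroup_injective ((toGroup_frac _ _).trans (Eq.trans ?_ (toGroup_frac _ _).symm))
  exact (mul_inv_cancel _).trans (mul_inv_cancel _).symm

/-- The Cuntz-Krieger relation for cylinder functions: a boundary path starting at a regular vertex
has a first edge. -/
theorem cylFun_nil_eq_sum {x : Γ.V} (hfin : {e : Γ.E | Γ.s e = x}.Finite)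
    (hne : {e : Γ.E | Γ.s e = x}.Nonempty) (ξ : BoundaryPath Γ) :
    cylFun K x [] ξ = ∑ e ∈ hfin.toFinset, cylFun K x [e] ξ := by
  by_cases hξ : ξ.source = x
  · obtain ⟨e, he⟩ : ∃ e, HasInit [e] ξ := by
      cases ξ with
      | fin x' l y hl hy =>
        cases l with
        | nil =>
          obtain ⟨e, he⟩ := hne
          obtain rfl : x' = y := hl
          exact (hy e (he.trans hξ.symm)).elim
        | cons e l => exact ⟨e, l, rfl⟩
      | inf ξ h => exact ⟨ξ.head, rfl⟩
    obtain ⟨η, hη⟩ := he.exists_concat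
    have hs : Γ.s e = x := hη.isPath.1.trans hξ
    rw [Finset.sum_eq_single_of_mem e (by simpa using hs), cylFun_eq_one hξ he,
      cylFun_eq_one hξ (hasInit_nil ξ)]
    intro f _ hf
    refine cylFun_eq_zero fun _ h => ?_
    simpa [hf, hf.symm] using h.comparable he
  · rw [cylFun_eq_zero fun h => (hξ h).elim, Finset.sum_eq_zero]
    exact fun e _ => cylFun_eq_zero fun h => (hξ h).elim

theorem freeToSkewRing_eq_of_rel {a b : LeavittFree Γ K} (h : LeavittRel Γ K a b) :
    freeToSkewRing Γ K a = freeToSkewRing Γ K b := by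
  induction h with
  | vertex_mul_self x =>
    simp only [LeavittFree.vertex, map_mul, freeToSkewRing_gen]
    exact fracDelta_mul_fracDelta_left (s := []) _ _ _ _ _
  | vertex_mul_of_ne x y hxy =>
    simp only [LeavittFree.vertex, map_mul, freeToSkewRing_gen, map_zero]
    exact fracDelta_mul_fracDelta_of_ne hxy _ _ _ _
  | source_mul_edge e =>
    simp only [LeavittFree.vertex, LeavittFree.edge, map_mul, freeToSkewRing_gen]
    exact fracDelta_mul_fracDelta_left (s := [e]) _ _ _ _ _
  | edge_mul_range e =>
    simp only [LeavittFree.vertex, LeavittFree.edge, map_mul, freeToSkewRing_gen]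
    exact fracDelta_mul_fracDelta_left (a := [e]) (s := []) _ _ _ _ _
  | range_mul_ghost e =>
    simp only [LeavittFree.vertex, LeavittFree.ghost, map_mul, freeToSkewRing_gen]
    exact fracDelta_mul_fracDelta_left (s := []) _ _ _ _ _
  | ghost_mul_source e =>
    simp only [LeavittFree.vertex, LeavittFree.ghost, map_mul, freeToSkewRing_gen]
    exact fracDelta_mul_fracDelta_right (c := []) (d := []) (s := [e]) _ _ _ _ _
  | ghost_mul_self e =>
    simp only [LeavittFree.vertex, LeavittFree.ghost, LeavittFree.edge, map_mul,
      freeToSkewRing_gen]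
    exact fracDelta_mul_fracDelta_left (b := [e]) (s := []) _ _ _ _ _
  | ghost_mul_of_ne e f hef =>
    simp only [LeavittFree.ghost, LeavittFree.edge, map_mul, freeToSkewRing_gen, map_zero]
    by_cases hs : Γ.s e = Γ.s f
    · have h1 : genToSkewRing Γ K (.ghost e) = fracDelta K (x := of (Γ.r e)) (y := of (Γ.s e))
        (isPath_nil (Γ.r e)) (isPath_singleton e) := rfl
      have h2 : genToSkewRing Γ K (.edge f) = fracDelta K (x := of (Γ.s e)) (y := of (Γ.r f))
        (a := [f]) ⟨hs.symm, rfl⟩ (isPath_nil (Γ.r f)) := by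
        simp only [genToSkewRing]
        congr 1
        exact congrArg of hs.symm
      rw [h1, h2]
      exact fracDelta_mul_fracDelta_of_not_prefix _ _ _ _ (by simpa using hef)
        (by simpa using hef.symm)
    · exact fracDelta_mul_fracDelta_of_ne hs _ _ _ _
  | cuntzKrieger x hfin hne =>
    simp only [LeavittFree.vertex, LeavittFree.ghost, LeavittFree.edge, map_mul, map_sum,
      freeToSkewRing_gen]
    rw [← Finset.sum_attach, Finset.sum_congr rfl fun e _ =>
      genToSkewRing_edge_mul_ghost (K := K) (hfin.mem_toFinset.1 e.2), ← map_sum]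
    refine PartialAction.delta_congr rfl (Subtype.ext (funext fun ξ => ?_))
    simp only [AddSubmonoidClass.coe_finsetSum, Finset.sum_apply]
    change cylFun K x [] ξ = ∑ e ∈ hfin.toFinset.attach, cylFun K x [e.1] ξ
    rw [Finset.sum_attach hfin.toFinset fun e => cylFun K x [e] ξ]
    exact cylFun_nil_eq_sum hfin hne ξ
  | smul c a b _ h => rw [map_smul, map_smul, h]

variable (Γ K) in
/-- The homomorphism from the Leavitt path algebra to the skew ring. -/
noncomputable def toSkewRing : LeavittPathAlgebra Γ K →ₙₐ[K] (pathAction Γ K).SkewRing :=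
  lift (freeToSkewRing Γ K) fun _ _ => freeToSkewRing_eq_of_rel

theorem toSkewRing_gen (t : LeavittGen Γ) :
    toSkewRing Γ K (mk (LeavittFree.gen K t)) = genToSkewRing Γ K t :=
  freeToSkewRing_gen t

variable {x y z : Γ.V} {a b : List Γ.E}

theorem toSkewRing_path (ha : Γ.IsPath x a z) :
    toSkewRing Γ K (path K x a) = fracDelta K (x := of x) (y := of z) ha (isPath_nil z) := by
  induction a generalizing x with
  | nil =>
    obtain rfl : x = z := ha
    exact toSkewRing_gen _
  | cons e a ih =>
    obtain ⟨rfl, ha⟩ := ha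
    rw [path, map_mul, ih ha]
    refine (congrArg (· * _) (toSkewRing_gen (.edge e))).trans ?_
    exact fracDelta_mul_fracDelta_left (a := [e]) (b := []) (s := a) _ _ _ _ _

theorem toSkewRing_ghostPath (hb : Γ.IsPath y b z) :
    toSkewRing Γ K (ghostPath K y b) = fracDelta K (x := of z) (y := of y) (isPath_nil z) hb := by
  induction b generalizing y with
  | nil =>
    obtain rfl : y = z := hb
    exact toSkewRing_gen _
  | cons e b ih =>
    obtain ⟨rfl, hb⟩ := hb
    rw [ghostPath, map_mul, ih hb]
    refine (congrArg (_ * ·) (toSkewRing_gen (.ghost e))).trans ?_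
    exact fracDelta_mul_fracDelta_right (c := []) (d := [e]) (s := b) _ _ _ _ _

theorem toSkewRing_path_mul_ghostPath (ha : Γ.IsPath x a z) (hb : Γ.IsPath y b z) :
    toSkewRing Γ K (path K x a * ghostPath K y b) = fracDelta K (x := of x) (y := of y) ha hb := by
  rw [map_mul, toSkewRing_path ha, toSkewRing_ghostPath hb]
  have hb' : Γ.IsPath (of y).vertex (b ++ []) z := by rwa [List.append_nil]
  refine (fracDelta_mul_fracDelta_right (c := []) (s := []) _ _ _ _ hb').trans ?_
  simp only [List.append_nil]

theorem toSkewRing_surjective : Function.Surjective (toSkewRing Γ K) := by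
  intro f
  induction f using PartialAction.skewRing_induction with
  | zero => exact ⟨0, map_zero _⟩
  | add f f' h h' =>
    obtain ⟨t, rfl⟩ := h
    obtain ⟨t', rfl⟩ := h'
    exact ⟨t + t', map_add _ _ _⟩
  | @delta x y g f =>
    by_cases hg : ∃ a b, IsFrac g a b
    · obtain ⟨a, b, hg⟩ := hg
      have hf := mem_span_of_mem_DIdeal hg f.2
      suffices ∃ (h : (f : DX Γ K).1 ∈ DX Γ K) (h' : (⟨_, h⟩ : DX Γ K) ∈ DIdeal K g) (t : _),
          toSkewRing Γ K t = (pathAction Γ K).delta g ⟨⟨_, h⟩, h'⟩ from this.2.2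
      generalize (f : DX Γ K).1 = f at hf
      induction hf using Submodule.span_induction with
      | zero =>
        exact ⟨zero_mem _, zero_mem _, 0, (map_zero _).trans (LinearMap.map_zero _).symm⟩
      | add f f' _ _ h h' =>
        obtain ⟨h1, h2, t, ht⟩ := h
        obtain ⟨h1', h2', t', ht'⟩ := h'
        refine ⟨add_mem h1 h1', add_mem h2 h2', t + t', ?_⟩
        rw [map_add, ht, ht']
        exact (LinearMap.map_add _ _ _).symm
      | smul c f _ h =>
        obtain ⟨h1, h2, t, ht⟩ := h
        refine ⟨SMulMemClass.smul_mem c h1, SMulMemClass.smul_mem (s := DIdeal K g) c h2,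
          c • t, ?_⟩
        rw [map_smul, ht]
        exact (LinearMap.map_smul _ _ _).symm
      | mem f hf =>
        obtain ⟨t, rfl⟩ := hf
        have hmem : cylElt K x.vertex (a ++ t) ∈ DIdeal K g := by
          rw [mem_DIdeal_iff, hg.XSet_eq]
          exact fun ξ hξ => cylFun_eq_zero fun h1 h2 =>
            hξ (cylSet_append_subset _ _ _ ⟨h1, h2⟩)
        refine ⟨cylFun_mem_DX _ _, hmem, ?_⟩
        by_cases hp : ∃ z, Γ.IsPath x.vertex (a ++ t) z
        · obtain ⟨z, hz⟩ := hp
          obtain ⟨p, ha, ht⟩ := pathOf_append.1 hz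
          obtain ⟨p', ha', hb⟩ := hg.exists_isPath
          obtain rfl := pathOf_end_unique ha ha'
          have hbt : Γ.IsPath y.vertex (b ++ t) z := pathOf_append.2 ⟨p, hb, ht⟩
          refine ⟨path K x.vertex (a ++ t) * ghostPath K y.vertex (b ++ t), ?_⟩
          refine (toSkewRing_path_mul_ghostPath hz hbt).trans ?_
          refine PartialAction.delta_congr (toGroup_injective ?_) rfl
          have h : posGroup (a ++ t) * (posGroup (b ++ t))⁻¹ = toGroup g := by
            rw [hg.toGroup_eq, posGroup_append, posGroup_append]
            group
          exact (toGroup_frac (x := x) (y := y) hz hbt).trans h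
        · refine ⟨0, (map_zero _).trans ?_⟩
          refine Eq.trans (LinearMap.map_zero ((pathAction Γ K).delta g)).symm ?_
          refine PartialAction.delta_congr rfl (Subtype.ext (funext fun ξ => ?_))
          exact (cylFun_eq_zero fun h1 h2 => hp (exists_isPath_of_mem_cylSet ⟨h1, h2⟩)).symm
    · have : f = 0 := Subtype.ext (eq_zero_of_mem_DIdeal hg f.2)
      rw [this]
      exact ⟨0, (map_zero _).trans (LinearMap.map_zero _).symm⟩

variable (Γ K) in
/-- The left inverse of `toSkewRing`, given by `f δ_g ↦ f · a b*` for `g = a b⁻¹` in reduced form.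
The function `f` acts on the left through a linear extension of `1_c ↦ cc*`. -/
noncomputable def ofSkewRing : (pathAction Γ K).SkewRing →ₗ[K] LeavittPathAlgebra Γ K :=
  DirectSum.toModule K (Quiver.Total (FreePathGroupoid Γ)) (LeavittPathAlgebra Γ K) fun g =>
    { toFun := fun f => (exists_linearMap_cylFun g.left.vertex).choose (f : DX Γ K).1 *
        (path K g.left.vertex (num g.hom) * ghostPath K g.right.vertex (den g.hom))
      map_add' := fun f f' => by
        rw [← add_mul, ← map_add]
        rfl
      map_smul' := fun c f => by
        rw [RingHom.id_apply, ← smul_mul_assoc, ← map_smul]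
        rfl }

theorem ofSkewRing_delta {x y : FreePathGroupoid Γ} (g : x ⟶ y) (f : (pathAction Γ K).D g) :
    ofSkewRing Γ K ((pathAction Γ K).delta g f) =
      (exists_linearMap_cylFun x.vertex).choose (f : DX Γ K).1 *
        (path K x.vertex (num g) * ghostPath K y.vertex (den g)) :=
  DirectSum.toModule_lof K (M := fun g : Quiver.Total _ => (pathAction Γ K).D g.hom) ⟨x, y, g⟩ f

theorem ofSkewRing_fracDelta (ha : Γ.IsPath x a z) (hb : Γ.IsPath y b z) :
    ofSkewRing Γ K (fracDelta K (x := of x) (y := of y) ha hb) =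
      path K x a * ghostPath K y b := by
  refine (ofSkewRing_delta _ _).trans ?_
  change (exists_linearMap_cylFun x).choose (cylFun K x a) * (path K x _ * ghostPath K y _) = _
  rw [(exists_linearMap_cylFun x).choose_spec, cylProj_eq ha]
  obtain ⟨a₀, b₀, c, hg, rfl, rfl⟩ :=
    exists_isFrac_of_toGroup_eq (toGroup_frac (x := of x) (y := of y) ha hb)
  rw [hg.num_eq, hg.den_eq]
  obtain ⟨p, ha₀, hb₀⟩ := hg.exists_isPath
  obtain ⟨p', ha', hc⟩ := pathOf_append.1 ha
  obtain rfl := pathOf_end_unique ha₀ ha'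
  replace ha₀ : Γ.IsPath x a₀ p := ha₀
  replace hb₀ : Γ.IsPath y b₀ p := hb₀
  rw [ghostPath_append ha₀ hc, ghostPath_append hb₀ hc, mul_assoc, mul_assoc,
    ← mul_assoc (ghostPath K x a₀), ghostPath_mul_path ha₀, vertex_mul_ghostPath hb₀]

theorem ofSkewRing_toSkewRing (t : LeavittPathAlgebra Γ K) :
    ofSkewRing Γ K (toSkewRing Γ K t) = t := by
  have ht := mem_span_path_mul_ghostPath t
  induction ht using Submodule.span_induction with
  | mem t h =>
    obtain ⟨x, y, z, a, b, ha, hb, rfl⟩ := h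
    rw [toSkewRing_path_mul_ghostPath ha hb, ofSkewRing_fracDelta]
  | zero => rw [map_zero, map_zero]
  | add t t' _ _ h h' => rw [map_add, map_add, h, h']
  | smul c t _ h => rw [map_smul, map_smul, h]

end LeavittPathAlgebra

open LeavittPathAlgebra

theorem mainTheorem1 (K : Type w) [Field K] (Γ : DirectedGraph.{u, v}) :
    ∃ (A : PartialAction K (FreePathGroupoid Γ) (DX Γ K))
      (hD : ∀ {x y : FreePathGroupoid Γ} (g : x ⟶ y), A.D g = DIdeal K g),
      (∀ {x y : FreePathGroupoid Γ} (g : x ⟶ y) (f : A.D (Groupoid.inv g)),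
        ((A.act g f : DX Γ K) : BoundaryPath Γ → K) =
          alpha K g ((f : DX Γ K) : BoundaryPath Γ → K)) ∧
      ∃ φ : LeavittPathAlgebra Γ K →ₙₐ[K] A.SkewRing,
        Function.Bijective φ ∧
        (∀ e : Γ.E, φ (LeavittPathAlgebra.edge K e) =
          A.delta (ofEdge e) ⟨charElt K (ofEdge e), (hD _).ge (charElt_mem_DIdeal K _)⟩) ∧
        (∀ e : Γ.E, φ (LeavittPathAlgebra.ghost K e) =
          A.delta (Groupoid.inv (ofEdge e))
            ⟨charElt K (Groupoid.inv (ofEdge e)), (hD _).ge (charElt_mem_DIdeal K _)⟩) ∧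
        (∀ x : Γ.V, φ (LeavittPathAlgebra.vertex K x) =
          A.delta (𝟙 (FreePathGroupoid.of x))
            ⟨charElt K (𝟙 (FreePathGroupoid.of x)), (hD _).ge (charElt_mem_DIdeal K _)⟩) := by
  refine ⟨pathAction Γ K, fun _ => rfl, fun _ _ => rfl, toSkewRing Γ K,
    ⟨Function.LeftInverse.injective ofSkewRing_toSkewRing, toSkewRing_surjective⟩,
    fun e => ?_, fun e => ?_, fun x => ?_⟩
  · have h : IsFrac (ofEdge e) [e] [] := rfl
    refine (toSkewRing_gen (.edge e)).trans (PartialAction.delta_congr (toGroup_injective ?_)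
      (Subtype.ext h.charFun_eq.symm))
    exact (toGroup_frac _ _).trans h.toGroup_eq.symm
  · have h : IsFrac (Groupoid.inv (ofEdge e)) [] [e] := rfl
    refine (toSkewRing_gen (.ghost e)).trans (PartialAction.delta_congr (toGroup_injective ?_)
      (Subtype.ext h.charFun_eq.symm))
    exact (toGroup_frac _ _).trans h.toGroup_eq.symm
  · have h : IsFrac (𝟙 (of x)) [] [] := rfl
    refine (toSkewRing_gen (.vertex x)).trans (PartialAction.delta_congr (toGroup_injective ?_)
      (Subtype.ext h.charFun_eq.symm))
    exact (toGroup_frac _ _).trans h.toGroup_eq.symm
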